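/- **Guarded interaction trees.** Work with complete ordered families of equivalences (COFEs, the step-indexed model of guarded type theory); $X \to Y$ denotes the COFE of non-expansive maps, $\blacktriangleright$ the later modality with embedding $\mathsf{Next} : X \to \blacktriangleright X$, and $\blacktriangleright f : \blacktriangleright X \to \blacktriangleright Y$ the lifting of $f : X \to Y$. Let $A = \mathbb{N} + B$ for an arbitrary COFE $B$. Let $\mathbb{IT}$ be the solution of the guarded recursive equation with constructors $$\mathsf{Ret} : A \to \mathbb{IT},\quad \mathsf{Fun} : \blacktriangleright(\mathbb{IT}\to\mathbb{IT}) \to \mathbb{IT},\quad \mathsf{Err} : \mathsf{Error} \to \mathbb{IT},\quad \mathsf{Tau} : \blacktriangleright\mathbb{IT} \to \mathbb{IT},$$ $$\mathsf{Vis} : \prod_{i \in \{\mathtt{callcc}, \mathtt{throw}\}} \big(\mathrm{Ins}_i(\mathbb{IT}) \times (\mathrm{Outs}_i(\mathbb{IT}) \to \blacktriangleright\mathbb{IT})\big) \to \mathbb{IT},$$ for the effect signature $\mathrm{Ins}_{\mathtt{callcc}}(X) = (\blacktriangleright X \to \blacktriangleright X) \to \blacktriangleright X$, $\mathrm{Outs}_{\mathtt{callcc}}(X)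 = \blacktriangleright X$, $\mathrm{Ins}_{\mathtt{throw}}(X) = \blacktriangleright X \times \blacktriangleright(X \to X)$, $\mathrm{Outs}_{\mathtt{throw}}(X) = 0$. Put $\mathsf{Tick}(\alpha) = \mathsf{Tau}(\mathsf{Next}(\alpha))$, $\mathsf{CALLCC}(f) = \mathsf{Vis}_{\mathtt{callcc}}(f, \mathrm{id})$ and $\mathsf{THROW}(\alpha, f) = \mathsf{Vis}_{\mathtt{throw}}((\mathsf{Next}(\alpha), f), \mathsf{elim}_0)$. The values of $\mathbb{IT}$ are the trees $\mathsf{Ret}(a)$ and $\mathsf{Fun}(g)$. The map $\mathsf{getval}(-, f)$ is given by guarded recursion: it applies $f$ to values, fixes $\mathsf{Err}(e)$, and satisfies $\mathsf{getval}(\mathsf{Tau}(t), f) = \mathsf{Tau}(\blacktriangleright\mathsf{getval}(t,f))$ and $\mathsf{getval}(\mathsf{Vis}_i(x,k), f) = \mathsf{Vis}_i(x, \blacktriangleright\mathsf{getval}(-,f) \circ k)$. The map $\mathsf{getfun}(-,f)$ is $\mathsf{getval}(-,f')$, where $f'(\mathsf{Fun}(g)) = f(g)$ and $f'(\mathsf{Ret}(a))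 = \mathsf{Err}(\mathsf{RunTime})$. **Reification and reduction.** The context-dependent reifiers, with trivial state type $1 = \{()\}$, are $$r_{\mathtt{callcc}}(f, (), \kappa) = \mathsf{Some}(\kappa\,(f\,\kappa), ()), \qquad r_{\mathtt{throw}}((\alpha, f), (), \kappa) = \mathsf{Some}(f\,\alpha, ()),$$ where $f\,\alpha \in \blacktriangleright\mathbb{IT}$ is application under $\blacktriangleright$. If $r_i(x,\sigma,\kappa) = \mathsf{Some}(\beta,\sigma')$ then $\mathsf{reify}(\mathsf{Vis}_i(x,\kappa),\sigma) = (\mathsf{Tau}(\beta),\sigma')$; if $r_i(x,\sigma,\kappa) = \mathsf{None}$ then $\mathsf{reify}(\mathsf{Vis}_i(x,\kappa),\sigma) = (\mathsf{Err}(\mathsf{RunTime}),\sigma)$. Write $(\alpha,\sigma) \rightsquigarrow (\beta,\sigma')$ if either $\alpha = \mathsf{Tick}(\beta)$ and $\sigma = \sigma'$, or $\alpha = \mathsf{Vis}_i(x,k)$ for some $i,x,k$ and $\mathsf{reify}(\alpha,\sigma) = (\mathsf{Tick}(\beta),\sigma')$. Let $\rightsquigarrow^*$ be its reflexive transitive closure.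 **The language.** With $x, f$ ranging over variables, $n$ over natural numbers and $\oplus$ over functions $\mathbb{N}\to\mathbb{N}\to\mathbb{N}$, the (untyped, possibly open) syntax is $$e ::= v \mid x \mid e_1\,e_2 \mid e_1 \oplus e_2 \mid \mathsf{if}\ e_1\ \mathsf{then}\ e_2\ \mathsf{else}\ e_3 \mid \mathsf{callcc}\ (x.\,e) \mid \mathsf{throw}\ e_1\ e_2, \qquad v ::= n \mid \mathsf{rec}\ f\,x = e \mid \mathsf{cont}\ K,$$ $$K ::= \square \mid \mathsf{if}\ K\ \mathsf{then}\ e_1\ \mathsf{else}\ e_2 \mid K\,v \mid e\,K \mid e \oplus K \mid K \oplus v \mid \mathsf{throw}\ K\ e \mid \mathsf{throw}\ v\ K,$$ up to renaming of bound variables and with capture-avoiding substitution. Local reductions in a context $K$ are: $(\mathsf{rec}\ f\,x = e)\,v \mapsto_K e[v/x, (\mathsf{rec}\ f\,x = e)/f]$; $n \oplus m \mapsto_K$ the value of $\oplus$ at $n, m$; $\mathsf{if}\ n\ \mathsf{then}\ e_1\ \mathsf{else}\ e_2 \mapsto_K e_1$ if $n \neq 0$, and $\mapsto_K e_2$ if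 $n = 0$; $\mathsf{callcc}\ (x.\,e) \mapsto_K e[\mathsf{cont}\ K/x]$. One operational step $e_1 \mapsto e_2$ is either $K[e] \mapsto K[e']$ with $e \mapsto_K e'$, or $K[\mathsf{throw}\ v\ (\mathsf{cont}\ K')] \mapsto K'[v]$. **Denotations.** For an environment $\rho : \mathrm{Var} \to \mathbb{IT}$, variables denote $\rho(x)$ and $n$ denotes $\mathsf{Ret}(n)$. Application denotes call-by-value application of trees: the argument and then the function are evaluated to a value $\beta_v$ and a function $\mathsf{Fun}(g)$ by $\mathsf{getval}$ and $\mathsf{getfun}$, with result $\mathsf{Tau}(g\,(\mathsf{Next}\ \beta_v))$, application again being under $\blacktriangleright$. The operation $e_1 \oplus e_2$ evaluates the right and then the left operand to values by $\mathsf{getval}$ and returns $\mathsf{Ret}$ of the result, or $\mathsf{Err}(\mathsf{RunTime})$ if these are not natural numbers. The conditional evaluates its condition to a value by $\mathsf{getval}$ and selects the first branch on non-zero numbers, the second on $0$, and $\mathsf{Err}(\mathsf{RunTime})$ otherwise. $[\![\mathsf{rec}\ f\,x=e]\!]_\rho$ is the guarded fixed point with $[\![\mathsf{rec}\ f\,x=e]\!]_\rho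 = \mathsf{Fun}(\mathsf{Next}(\lambda a.\ [\![e]\!]_{\rho[f \mapsto [\![\mathsf{rec}\ f\,x=e]\!]_\rho,\ x \mapsto a]}))$. Moreover $$[\![\mathsf{callcc}\ (x.\,e)]\!]_\rho = \mathsf{CALLCC}(\lambda f.\ \mathsf{Next}([\![e]\!]_{\rho[x \mapsto \mathsf{Fun}(\mathsf{Next}(\lambda y.\,\mathsf{Tau}(f(\mathsf{Next}\,y))))]})),$$ $$[\![\mathsf{throw}\ e_1\ e_2]\!]_\rho = \mathsf{getval}([\![e_1]\!]_\rho, \lambda x.\ \mathsf{getfun}([\![e_2]\!]_\rho, \lambda f.\ \mathsf{THROW}(x,f))),$$ $$[\![\mathsf{cont}\ K]\!]_\rho = \mathsf{Fun}(\mathsf{Next}(\lambda x.\ \mathsf{Tau}((\blacktriangleright[\![K]\!]_\rho)(\mathsf{Next}\,x)))),$$ where $[\![K]\!]_\rho : \mathbb{IT} \to \mathbb{IT}$ interprets contexts by the same clauses, with the argument in place of the hole $\square$. **Soundness.** Suppose $e_1 \mapsto e_2$ in one operational step. Then for every environment $\rho : \mathrm{Var} \to \mathbb{IT}$, $$([\![e_1]\!]_\rho,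 ()) \rightsquigarrow^* ([\![e_2]\!]_\rho, ()),$$ where $() : 1$ is the unique element of the unit type. -/

import Mathlib

/-! # Complete ordered families of equivalences -/

namespace GITree

/-- A complete ordered family of equivalences: the types of guarded type theory.
`dist n x y` says that `x` and `y` agree up to step index `n`. -/
class COFE (α : Type) where
  dist : ℕ → α → α → Prop
  dist_refl : ∀ n x, dist n x x
  dist_symm : ∀ {n x y}, dist n x y → dist n y x
  dist_trans : ∀ {n x y z}, dist n x y → dist n y z → dist n x z
  dist_pred : ∀ {n x y}, dist (n + 1) x y → dist n x y
  eq_of_dist : ∀ {x y}, (∀ n, dist n x y) → x = y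
  complete : ∀ c : ℕ → α, (∀ n, dist n (c n) (c (n + 1))) → ∃ l, ∀ n, dist n (c n) l

open COFE

theorem dist_of_le {α : Type} [COFE α] {m n : ℕ} (h : m ≤ n) {x y : α} (hd : dist n x y) :
    dist m x y := by
  induction h with
  | refl => exact hd
  | step _ ih => exact ih (dist_pred hd)

theorem chain_le {α : Type} [COFE α] {c : ℕ → α} (hc : ∀ n, dist n (c n) (c (n + 1)))
    {n k : ℕ} (h : n ≤ k) : dist n (c n) (c k) := by
  induction h with
  | refl => exact dist_refl _ _
  | step hk ih => exact dist_trans ih (dist_of_le hk (hc _))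

/-- The discrete structure, where agreement is equality at every index. -/
@[reducible] def COFE.discrete (α : Type) : COFE α where
  dist _ x y := x = y
  dist_refl _ _ := rfl
  dist_symm h := h.symm
  dist_trans h h' := h.trans h'
  dist_pred h := h
  eq_of_dist h := h 0
  complete c hc := ⟨c 0, fun n => by
    induction n with
    | zero => rfl
    | succ n ih => exact (hc n).symm.trans ih⟩

instance : COFE ℕ := COFE.discrete ℕ
instance : COFE Unit := COFE.discrete Unit
instance : COFE Empty := COFE.discrete Empty

/-! ### The later modality -/

/-- The later modality on types; `Later.next` is the embedding `Next`. -/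
structure Later (X : Type) where
  next ::
  val : X

prefix:max "▶" => Later

instance {X : Type} [COFE X] : COFE ▶X where
  dist n x y := ∀ m < n, dist m x.val y.val
  dist_refl _ _ _ _ := dist_refl _ _
  dist_symm h m hm := dist_symm (h m hm)
  dist_trans h h' m hm := dist_trans (h m hm) (h' m hm)
  dist_pred h m hm := h m (Nat.lt_succ_of_lt hm)
  eq_of_dist {x y} h := by
    cases x; cases y
    exact congrArg _ (eq_of_dist fun n => h (n + 1) n (Nat.lt_succ_self n))
  complete c hc := by
    have hd : ∀ n, dist n (c (n + 1)).val (c (n + 1 + 1)).val :=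
      fun n => hc (n + 1) n (Nat.lt_succ_self n)
    obtain ⟨l, hl⟩ := complete (fun n => (c (n + 1)).val) hd
    refine ⟨⟨l⟩, fun n m hm => ?_⟩
    obtain ⟨k, rfl⟩ : ∃ k, n = k + 1 := ⟨n - 1, by omega⟩
    exact dist_of_le (Nat.lt_succ_iff.mp hm) (hl k)

/-! ### Non-expansive maps -/

/-- Non-expansive maps: the function types of guarded type theory. -/
@[ext] structure Hom (X Y : Type) [COFE X] [COFE Y] where
  toFun : X → Y
  ne : ∀ {n x y}, dist n x y → dist n (toFun x) (toFun y)

infixr:25 " →ₙₑ " => Hom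

instance {X Y : Type} [COFE X] [COFE Y] : CoeFun (X →ₙₑ Y) (fun _ => X → Y) := ⟨Hom.toFun⟩

instance {X Y : Type} [COFE X] [COFE Y] : COFE (X →ₙₑ Y) where
  dist n f g := ∀ x, dist n (f x) (g x)
  dist_refl _ _ _ := dist_refl _ _
  dist_symm h x := dist_symm (h x)
  dist_trans h h' x := dist_trans (h x) (h' x)
  dist_pred h x := dist_pred (h x)
  eq_of_dist h := Hom.ext (funext fun x => eq_of_dist fun n => h n x)
  complete c hc := by
    choose l hl using fun x => complete (fun n => c n x) (fun n => hc n x)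
    exact ⟨⟨l, fun {n x y} h =>
      dist_trans (dist_symm (hl x n)) (dist_trans ((c n).ne h) (hl y n))⟩, fun n x => hl x n⟩

theorem Hom.dist_app {X Y : Type} [COFE X] [COFE Y] {n : ℕ} {f g : X →ₙₑ Y} {x y : X}
    (hf : dist n f g) (hx : dist n x y) : dist n (f x) (g y) :=
  dist_trans (hf x) (g.ne hx)

def Hom.id (X : Type) [COFE X] : X →ₙₑ X := ⟨fun x => x, fun h => h⟩

def Hom.comp {X Y Z : Type} [COFE X] [COFE Y] [COFE Z] (g : Y →ₙₑ Z) (f : X →ₙₑ Y) : X →ₙₑ Z :=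
  ⟨fun x => g (f x), fun h => g.ne (f.ne h)⟩

def Hom.const {X Y : Type} [COFE X] [COFE Y] (y : Y) : X →ₙₑ Y :=
  ⟨fun _ => y, fun _ => dist_refl _ _⟩

/-- The unique map `elim` out of the empty type. -/
def Hom.elim (Y : Type) [COFE Y] : Empty →ₙₑ Y := ⟨fun x => x.elim, fun {_ x} _ => x.elim⟩

/-- Curried binary non-expansive maps. -/
def Hom.mk₂ {X Y Z : Type} [COFE X] [COFE Y] [COFE Z] (f : X → Y → Z)
    (hf : ∀ {n x x' y y'}, dist n x x' → dist n y y' → dist n (f x y) (f x' y')) :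
    X →ₙₑ (Y →ₙₑ Z) :=
  ⟨fun x => ⟨f x, fun h => hf (dist_refl _ _) h⟩, fun h _ => hf h (dist_refl _ _)⟩

/-- Application under the later modality. -/
def Later.ap {X Y : Type} [COFE X] [COFE Y] (g : ▶(X →ₙₑ Y)) (x : ▶X) : ▶Y :=
  .next (g.val x.val)

/-- The functorial action `▶f : ▶X → ▶Y` of a map `f`. -/
def Later.map {X Y : Type} [COFE X] [COFE Y] (f : X →ₙₑ Y) : ▶X →ₙₑ ▶Y :=
  ⟨fun x => .next (f x.val), fun h m hm => f.ne (h m hm)⟩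

theorem Later.dist_ap {X Y : Type} [COFE X] [COFE Y] {n : ℕ} {g g' : ▶(X →ₙₑ Y)} {x x' : ▶X}
    (hg : dist n g g') (hx : dist n x x') : dist n (Later.ap g x) (Later.ap g' x') :=
  fun m hm => Hom.dist_app (hg m hm) (hx m hm)

/-- Existence of guarded fixed points. -/
theorem exists_fix {X : Type} [COFE X] [Nonempty X] (f : ▶X →ₙₑ X) :
    ∃ x : X, f (.next x) = x := by
  obtain ⟨x₀⟩ := ‹Nonempty X›
  let c : ℕ → X := fun n => Nat.rec (f (.next x₀)) (fun _ x => f (.next x)) n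
  have hc : ∀ n, dist n (c n) (c (n + 1)) := by
    intro n
    induction n with
    | zero => exact f.ne fun m hm => absurd hm (Nat.not_lt_zero m)
    | succ n ih => exact f.ne fun m hm => dist_of_le (Nat.lt_succ_iff.mp hm) ih
  obtain ⟨l, hl⟩ := complete c hc
  refine ⟨l, eq_of_dist fun n => ?_⟩
  have h1 : dist n (f (.next l)) (f (.next (c n))) :=
    f.ne fun m hm => dist_symm (dist_of_le hm.le (hl n))
  exact dist_trans h1 (dist_of_le (Nat.le_succ n) (hl (n + 1)))

/-- The guarded fixed point combinator `fix : (▶X → X) → X`. -/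
noncomputable def fix {X : Type} [COFE X] [Nonempty X] (f : ▶X →ₙₑ X) : X := (exists_fix f).choose

theorem fix_eq {X : Type} [COFE X] [Nonempty X] (f : ▶X →ₙₑ X) : f (.next (fix f)) = fix f :=
  (exists_fix f).choose_spec

/-! ### Products, sums, options, families -/

instance {X Y : Type} [COFE X] [COFE Y] : COFE (X × Y) where
  dist n p q := dist n p.1 q.1 ∧ dist n p.2 q.2
  dist_refl _ _ := ⟨dist_refl _ _, dist_refl _ _⟩
  dist_symm h := ⟨dist_symm h.1, dist_symm h.2⟩
  dist_trans h h' := ⟨dist_trans h.1 h'.1, dist_trans h.2 h'.2⟩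
  dist_pred h := ⟨dist_pred h.1, dist_pred h.2⟩
  eq_of_dist h := Prod.ext (eq_of_dist fun n => (h n).1) (eq_of_dist fun n => (h n).2)
  complete c hc := by
    obtain ⟨l, hl⟩ := complete (fun n => (c n).1) (fun n => (hc n).1)
    obtain ⟨r, hr⟩ := complete (fun n => (c n).2) (fun n => (hc n).2)
    exact ⟨(l, r), fun n => ⟨hl n, hr n⟩⟩

instance {ι X : Type} [COFE X] : COFE (ι → X) where
  dist n f g := ∀ i, dist n (f i) (g i)
  dist_refl _ _ _ := dist_refl _ _
  dist_symm h i := dist_symm (h i)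
  dist_trans h h' i := dist_trans (h i) (h' i)
  dist_pred h i := dist_pred (h i)
  eq_of_dist h := funext fun i => eq_of_dist fun n => h n i
  complete c hc := by
    choose l hl using fun i => complete (fun n => c n i) (fun n => hc n i)
    exact ⟨l, fun n i => hl i n⟩

inductive SumDist {X Y : Type} [COFE X] [COFE Y] (n : ℕ) : X ⊕ Y → X ⊕ Y → Prop
  | inl {x x'} (h : dist n x x') : SumDist n (.inl x) (.inl x')
  | inr {y y'} (h : dist n y y') : SumDist n (.inr y) (.inr y')

instance {X Y : Type} [COFE X] [COFE Y] : COFE (X ⊕ Y) where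
  dist := SumDist
  dist_refl n x := by cases x <;> constructor <;> exact dist_refl _ _
  dist_symm h := by cases h <;> constructor <;> exact dist_symm ‹_›
  dist_trans h h' := by cases h <;> cases h' <;> constructor <;> exact dist_trans ‹_› ‹_›
  dist_pred h := by cases h <;> constructor <;> exact dist_pred ‹_›
  eq_of_dist {x y} h := by
    cases h 0
    · exact congrArg _ (eq_of_dist fun n => by cases h n; assumption)
    · exact congrArg _ (eq_of_dist fun n => by cases h n; assumption)
  complete c hc := by
    rcases h0 : c 0 with x | y
    · have hs : ∀ n, ∃ x, c n = .inl x := by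
        intro n
        induction n with
        | zero => exact ⟨x, h0⟩
        | succ n ih =>
          obtain ⟨x, hx⟩ := ih
          have := hc n
          rw [hx] at this
          generalize c (n + 1) = z at this
          cases this
          exact ⟨_, rfl⟩
      choose d hd using hs
      obtain ⟨l, hl⟩ := complete d (fun n => by
        have := hc n
        rw [hd, hd] at this
        cases this
        assumption)
      exact ⟨.inl l, fun n => by rw [hd]; exact .inl (hl n)⟩
    · have hs : ∀ n, ∃ y, c n = .inr y := by
        intro n
        induction n with
        | zero => exact ⟨y, h0⟩
        | succ n ih =>
          obtain ⟨x, hx⟩ := ih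
          have := hc n
          rw [hx] at this
          generalize c (n + 1) = z at this
          cases this
          exact ⟨_, rfl⟩
      choose d hd using hs
      obtain ⟨l, hl⟩ := complete d (fun n => by
        have := hc n
        rw [hd, hd] at this
        cases this
        assumption)
      exact ⟨.inr l, fun n => by rw [hd]; exact .inr (hl n)⟩

inductive OptionDist {X : Type} [COFE X] (n : ℕ) : Option X → Option X → Prop
  | none : OptionDist n .none .none
  | some {x x'} (h : dist n x x') : OptionDist n (.some x) (.some x')

instance {X : Type} [COFE X] : COFE (Option X) where
  dist := OptionDist
  dist_refl n x := by cases x <;> constructor; exact dist_refl _ _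
  dist_symm h := by cases h <;> constructor; exact dist_symm ‹_›
  dist_trans h h' := by cases h <;> cases h' <;> constructor; exact dist_trans ‹_› ‹_›
  dist_pred h := by cases h <;> constructor; exact dist_pred ‹_›
  eq_of_dist {x y} h := by
    cases h 0
    · rfl
    · exact congrArg _ (eq_of_dist fun n => by cases h n; assumption)
  complete c hc := by
    rcases h0 : c 0 with _ | x
    · have hs : ∀ n, c n = .none := by
        intro n
        induction n with
        | zero => exact h0
        | succ n ih =>
          have := hc n
          rw [ih] at this
          generalize c (n + 1) = z at this
          cases this
          rfl
      exact ⟨.none, fun n => by rw [hs]; exact .none⟩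
    · have hs : ∀ n, ∃ x, c n = .some x := by
        intro n
        induction n with
        | zero => exact ⟨x, h0⟩
        | succ n ih =>
          obtain ⟨x, hx⟩ := ih
          have := hc n
          rw [hx] at this
          generalize c (n + 1) = z at this
          cases this
          exact ⟨_, rfl⟩
      choose d hd using hs
      obtain ⟨l, hl⟩ := complete d (fun n => by
        have := hc n
        rw [hd, hd] at this
        cases this
        assumption)
      exact ⟨.some l, fun n => by rw [hd]; exact .some (hl n)⟩

/-! # Mixed-variance functors and solutions of guarded domain equations -/

/-- Locally contractive functors of a contravariant and a covariant argument. -/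
structure OFunctor where
  obj : (X Y : Type) → [COFE X] → [COFE Y] → Type
  inst : (X Y : Type) → [COFE X] → [COFE Y] → COFE (obj X Y)
  map : {X X' Y Y' : Type} → [COFE X] → [COFE X'] → [COFE Y] → [COFE Y'] →
    (X' →ₙₑ X) → (Y →ₙₑ Y') → (obj X Y →ₙₑ obj X' Y')
  map_id : ∀ {X Y : Type} [COFE X] [COFE Y] (z : obj X Y), map (Hom.id X) (Hom.id Y) z = z
  map_comp : ∀ {X X' X'' Y Y' Y'' : Type} [COFE X] [COFE X'] [COFE X''] [COFE Y] [COFE Y']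
    [COFE Y''] (f : X' →ₙₑ X) (f' : X'' →ₙₑ X') (g : Y →ₙₑ Y') (g' : Y' →ₙₑ Y'') (z : obj X Y),
    map f' g' (map f g z) = map (f.comp f') (g'.comp g) z
  map_contractive : ∀ {X X' Y Y' : Type} [COFE X] [COFE X'] [COFE Y] [COFE Y'] {n : ℕ}
    {f f' : X' →ₙₑ X} {g g' : Y →ₙₑ Y'}, (∀ m < n, dist m f f' ∧ dist m g g') →
    dist n (map f g) (map f' g')

attribute [instance] OFunctor.inst

/-- The functor `X ↦ 0`. -/
def OFunctor.empty : OFunctor where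
  obj _ _ := Empty
  inst _ _ := inferInstance
  map _ _ := Hom.id Empty
  map_id _ := rfl
  map_comp _ _ _ _ _ := rfl
  map_contractive _ _ := dist_refl _ _

/-- The functor `X ↦ ▶X`. -/
def OFunctor.later : OFunctor where
  obj _ Y := ▶Y
  inst _ _ := inferInstance
  map _ g := Later.map g
  map_id _ := rfl
  map_comp _ _ _ _ _ := rfl
  map_contractive h x m hm := (h m hm).2 x.val

/-- The functor `X ↦ ▶(X → X)`. -/
def OFunctor.laterHom : OFunctor where
  obj X Y := ▶(X →ₙₑ Y)
  inst _ _ := inferInstance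
  map f g := ⟨fun z => .next ((g.comp z.val).comp f), fun h m hm x => g.ne (h m hm (f x))⟩
  map_id _ := rfl
  map_comp _ _ _ _ _ := rfl
  map_contractive {_ _ _ _ _ _ _ _ _ _ _ g g'} h z m hm x :=
    Hom.dist_app (f := g) (g := g') (h m hm).2 (z.val.ne ((h m hm).1 x))

/-- The functor `X ↦ F(X) × G(X)`. -/
def OFunctor.prod (F G : OFunctor) : OFunctor where
  obj X Y := F.obj X Y × G.obj X Y
  inst _ _ := inferInstance
  map f g := ⟨fun z => (F.map f g z.1, G.map f g z.2),
    fun h => ⟨(F.map f g).ne h.1, (G.map f g).ne h.2⟩⟩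
  map_id _ := Prod.ext (F.map_id _) (G.map_id _)
  map_comp _ _ _ _ _ := Prod.ext (F.map_comp _ _ _ _ _) (G.map_comp _ _ _ _ _)
  map_contractive h z := ⟨F.map_contractive h z.1, G.map_contractive h z.2⟩

/-- The functor `X ↦ (F(X) → G(X))`; the two variances are swapped in the domain. -/
def OFunctor.hom (F G : OFunctor) : OFunctor where
  obj X Y := F.obj Y X →ₙₑ G.obj X Y
  inst _ _ := inferInstance
  map f g := ⟨fun z => ((G.map f g).comp z).comp (F.map g f), fun h x => (G.map f g).ne (h _)⟩
  map_id z := Hom.ext (funext fun x => by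
    change G.map _ _ (z (F.map _ _ x)) = z x
    rw [F.map_id, G.map_id])
  map_comp f f' g g' z := Hom.ext (funext fun x => by
    change G.map _ _ (G.map _ _ (z (F.map _ _ (F.map _ _ x)))) = G.map _ _ (z (F.map _ _ x))
    rw [F.map_comp, G.map_comp])
  map_contractive {_ _ _ _ _ _ _ _ _ f f' g g'} h z x :=
    Hom.dist_app (f := G.map f g) (g := G.map f' g') (G.map_contractive h)
    (z.ne (F.map_contractive (fun m hm => ⟨(h m hm).2, (h m hm).1⟩) x))

/-- A functor with a natural point, which makes all approximants inhabited. -/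
structure PointedFunctor extends OFunctor where
  pt : (X Y : Type) → [COFE X] → [COFE Y] → obj X Y
  map_pt : ∀ {X X' Y Y' : Type} [COFE X] [COFE X'] [COFE Y] [COFE Y'] (f : X' →ₙₑ X)
    (g : Y →ₙₑ Y'), map f g (pt X Y) = pt X' Y'

structure Bundled where
  T : Type
  inst : COFE T

attribute [instance] Bundled.inst

section Solver

variable (F : PointedFunctor)

/-- The approximants `1, F(1,1), F(F(1,1),F(1,1)), …`. -/
def approx : ℕ → Bundled
  | 0 => ⟨Unit, inferInstance⟩
  | n + 1 => ⟨F.obj (approx n).T (approx n).T, inferInstance⟩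

def approxPt : ∀ n, (approx F n).T
  | 0 => ()
  | _ + 1 => F.pt _ _

/-- The map from the `k`-th to the `n`-th approximant: a projection if `n ≤ k`, an embedding
if `k ≤ n`. -/
def tr (n k : ℕ) : (approx F k).T →ₙₑ (approx F n).T :=
  match n, k with
  | 0, _ => Hom.const ()
  | n + 1, 0 => Hom.const (approxPt F (n + 1))
  | n + 1, k + 1 => F.map (tr k n) (tr n k)
termination_by n + k

theorem tr_zero_left (k : ℕ) (x) : tr F 0 k x = () := rfl

theorem tr_pt (n k : ℕ) : tr F n k (approxPt F k) = approxPt F n := by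
  cases n with
  | zero => rfl
  | succ n =>
    cases k with
    | zero => rw [tr]; rfl
    | succ k => rw [tr]; exact F.map_pt _ _

theorem tr_zero_right (n : ℕ) (x) : tr F n 0 x = approxPt F n := tr_pt F n 0

theorem tr_succ (n k : ℕ) : tr F (n + 1) (k + 1) = F.map (tr F k n) (tr F n k) := by rw [tr]

theorem tr_succ_apply (n k : ℕ) (x : F.obj (approx F k).T (approx F k).T) :
    tr F (n + 1) (k + 1) x = F.map (tr F k n) (tr F n k) x :=
  congrArg (fun f => Hom.toFun f x) (tr_succ F n k)

theorem tr_self (n : ℕ) : tr F n n = Hom.id _ := by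
  induction n with
  | zero => rfl
  | succ n ih =>
    rw [tr_succ, ih]
    exact Hom.ext (funext fun z => F.map_id z)

theorem tr_comp (n m k : ℕ) (h : n ≤ m ∨ k ≤ m) : (tr F n m).comp (tr F m k) = tr F n k := by
  induction m generalizing n k with
  | zero =>
    rcases h with h | h
    · obtain rfl : n = 0 := by omega
      rfl
    · obtain rfl : k = 0 := by omega
      exact Hom.ext (funext fun x => by
        change tr F n 0 (tr F 0 0 x) = tr F n 0 x
        rw [tr_zero_right, tr_zero_right])
  | succ m ih =>
    cases n with
    | zero => rfl
    | succ n =>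
      cases k with
      | zero =>
        exact Hom.ext (funext fun x => by
          change tr F _ _ (tr F _ _ x) = tr F _ _ x
          rw [tr_zero_right, tr_zero_right, tr_pt])
      | succ k =>
        have h1 := ih n k (by omega)
        have h2 := ih k n (by omega)
        rw [tr_succ, tr_succ, tr_succ, ← h1, ← h2]
        exact Hom.ext (funext fun z => F.map_comp _ _ _ _ z)

theorem tr_round (N k m : ℕ) (h : m < k) : dist m ((tr F N k).comp (tr F k N)) (Hom.id _) := by
  induction k generalizing N m with
  | zero => omega
  | succ k ih =>
    cases N with
    | zero => exact fun _ => rfl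
    | succ N =>
      have hf : (tr F (N + 1) (k + 1)).comp (tr F (k + 1) (N + 1))
          = F.map ((tr F N k).comp (tr F k N)) ((tr F N k).comp (tr F k N)) := by
        rw [tr_succ, tr_succ]
        exact Hom.ext (funext fun z => F.map_comp _ _ _ _ z)
      have hi : (Hom.id _ : (approx F (N + 1)).T →ₙₑ _) = F.map (Hom.id _) (Hom.id _) :=
        Hom.ext (funext fun z => (F.map_id z).symm)
      rw [hf, hi]
      exact F.map_contractive fun m' hm' => ⟨ih N m' (by omega), ih N m' (by omega)⟩

/-- The limit of the approximants. -/
@[ext] structure Limit : Type where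
  seq : ∀ n, (approx F n).T
  comm : ∀ n, tr F n (n + 1) (seq (n + 1)) = seq n

instance : COFE (Limit F) where
  dist n x y := ∀ k, dist n (x.seq k) (y.seq k)
  dist_refl _ _ _ := dist_refl _ _
  dist_symm h i := dist_symm (h i)
  dist_trans h h' i := dist_trans (h i) (h' i)
  dist_pred h i := dist_pred (h i)
  eq_of_dist h := Limit.ext (funext fun i => eq_of_dist fun n => h n i)
  complete c hc := by
    choose l hl using fun i => complete (fun n => (c n).seq i) (fun n => hc n i)
    refine ⟨⟨l, fun k => eq_of_dist fun n => ?_⟩, fun n i => hl i n⟩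
    have h1 := (tr F k (k + 1)).ne (hl (k + 1) n)
    rw [(c n).comm k] at h1
    exact dist_trans (dist_symm h1) (hl k n)

theorem Limit.compat (x : Limit F) {j k : ℕ} (h : j ≤ k) : tr F j k (x.seq k) = x.seq j := by
  induction h with
  | refl => rw [tr_self]; rfl
  | @step k hk ih =>
    have h1 := tr_comp F j k (k + 1) (Or.inl hk)
    calc tr F j (k + 1) (x.seq (k + 1)) = tr F j k (tr F k (k + 1) (x.seq (k + 1))) := by
          rw [← h1]; rfl
      _ = x.seq j := by rw [x.comm k, ih]

def Limit.proj (n : ℕ) : Limit F →ₙₑ (approx F n).T := ⟨fun x => x.seq n, fun h => h n⟩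

def Limit.emb (n : ℕ) : (approx F n).T →ₙₑ Limit F :=
  ⟨fun a => ⟨fun k => tr F k n a, fun k => by
    rw [← tr_comp F k (k + 1) n (Or.inl (Nat.le_succ k))]; rfl⟩, fun h k => (tr F k n).ne h⟩

theorem Limit.emb_tr {n k : ℕ} (h : k ≤ n) :
    (Limit.emb F n).comp (tr F n k) = Limit.emb F k :=
  Hom.ext (funext fun a => Limit.ext (funext fun j => by
    rw [show (Limit.emb F k a).seq j = tr F j k a from rfl, ← tr_comp F j n k (Or.inr h)]; rfl))

theorem Limit.tr_proj {n k : ℕ} (h : n ≤ k) :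
    (tr F n k).comp (Limit.proj F k) = Limit.proj F n :=
  Hom.ext (funext fun x => Limit.compat F x h)

theorem Limit.emb_proj {n k : ℕ} (h : n < k) :
    dist n ((Limit.emb F k).comp (Limit.proj F k)) (Hom.id _) := by
  intro x j
  change dist n (tr F j k (x.seq k)) (x.seq j)
  rcases le_total j k with hj | hj
  · rw [Limit.compat F x hj]; exact dist_refl _ _
  · rw [← Limit.compat F x hj]
    exact tr_round F j k n h (x.seq j)

/-- The map from `F(T, T)` to the limit `T`. -/
def Limit.fold : F.obj (Limit F) (Limit F) →ₙₑ Limit F :=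
  ⟨fun y => ⟨fun n => match n with
    | 0 => ()
    | n + 1 => F.map (Limit.emb F n) (Limit.proj F n) y,
    fun n => by
      cases n with
      | zero => rfl
      | succ n =>
        change tr F (n + 1) (n + 1 + 1) (F.map _ _ y) = F.map _ _ y
        rw [tr_succ, F.map_comp, Limit.emb_tr F (Nat.le_succ n), Limit.tr_proj F (Nat.le_succ n)]⟩,
  fun h n => match n with
    | 0 => rfl
    | n + 1 => (F.map (Limit.emb F n) (Limit.proj F n)).ne h⟩

theorem Limit.dist_of_fold {n : ℕ} {y y' : F.obj (Limit F) (Limit F)}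
    (h : dist n (Limit.fold F y) (Limit.fold F y')) : dist n y y' := by
  have key : ∀ z : F.obj (Limit F) (Limit F),
      dist n (F.map (Limit.proj F n) (Limit.emb F n)
        (F.map (Limit.emb F n) (Limit.proj F n) z)) z := by
    intro z
    rw [F.map_comp]
    have := F.map_contractive (n := n)
      (f := (Limit.emb F n).comp (Limit.proj F n)) (f' := Hom.id _)
      (g := (Limit.emb F n).comp (Limit.proj F n)) (g' := Hom.id _)
      (fun m hm => ⟨Limit.emb_proj F hm, Limit.emb_proj F hm⟩) z
    rwa [F.map_id] at this
  exact dist_trans (dist_symm (key y)) (dist_trans ((F.map _ _).ne (h (n + 1))) (key y'))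

theorem Limit.exists_fold (x : Limit F) : ∃ y, Limit.fold F y = x := by
  let c : ℕ → F.obj (Limit F) (Limit F) :=
    fun k => F.map (Limit.proj F k) (Limit.emb F k) (x.seq (k + 1))
  have hc : ∀ k, dist k (c k) (c (k + 1)) := by
    intro k
    have h1 : c k = F.map ((tr F (k + 1) k).comp (Limit.proj F k))
        ((Limit.emb F k).comp (tr F k (k + 1))) (x.seq (k + 1 + 1)) := by
      have h2 := (x.comm (k + 1)).symm.trans (tr_succ_apply F k (k + 1) (x.seq (k + 1 + 1)))
      exact (congrArg (F.map (Limit.proj F k) (Limit.emb F k)) h2).trans (F.map_comp _ _ _ _ _)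
    rw [h1]
    refine F.map_contractive (fun m hm => ⟨?_, ?_⟩) _
    · intro z
      rw [← Limit.tr_proj F (Nat.le_succ k)]
      exact tr_round F (k + 1) k m hm _
    · intro z
      rw [← Limit.emb_tr F (Nat.le_succ k)]
      exact (Limit.emb F (k + 1)).ne (tr_round F (k + 1) k m hm z)
  obtain ⟨y, hy⟩ := complete c hc
  refine ⟨y, eq_of_dist fun n j => ?_⟩
  cases j with
  | zero => exact rfl
  | succ j =>
    change dist n (F.map (Limit.emb F j) (Limit.proj F j) y) (x.seq (j + 1))
    let k := max n j
    have h1 : dist n (F.map (Limit.emb F j) (Limit.proj F j) (c k))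
        (F.map (Limit.emb F j) (Limit.proj F j) y) :=
      (F.map _ _).ne (dist_of_le (le_max_left n j) (hy k))
    have h2 : F.map (Limit.emb F j) (Limit.proj F j) (c k) = x.seq (j + 1) := by
      have h3 : (Limit.proj F k).comp (Limit.emb F j) = tr F k j := rfl
      have h4 : (Limit.proj F j).comp (Limit.emb F k) = tr F j k := rfl
      have h5 := F.map_comp (Limit.proj F k) (Limit.emb F j) (Limit.emb F k) (Limit.proj F j)
        (x.seq (k + 1))
      rw [h3, h4] at h5
      exact h5.trans ((tr_succ_apply F j k (x.seq (k + 1))).symm.trans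
        (Limit.compat F x (Nat.succ_le_succ (le_max_right n j))))
    rw [h2] at h1
    exact dist_symm h1

/-- The inverse of `fold`. -/
noncomputable def Limit.unfold : Limit F →ₙₑ F.obj (Limit F) (Limit F) :=
  ⟨fun x => (Limit.exists_fold F x).choose, fun {n x y} h => Limit.dist_of_fold F (by
    rw [(Limit.exists_fold F x).choose_spec, (Limit.exists_fold F y).choose_spec]; exact h)⟩

theorem Limit.fold_unfold (x : Limit F) : Limit.fold F (Limit.unfold F x) = x :=
  (Limit.exists_fold F x).choose_spec

theorem Limit.unfold_fold (y : F.obj (Limit F) (Limit F)) :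
    Limit.unfold F (Limit.fold F y) = y :=
  eq_of_dist fun n => Limit.dist_of_fold F (by
    rw [Limit.fold_unfold]; exact dist_refl n _)

end Solver

/-! # Guarded interaction trees -/

/-- Effect signatures: names of operations with their input and output arities. -/
structure Signature where
  I : Type
  Ins : I → OFunctor
  Outs : I → OFunctor

/-- Errors: the runtime error, and arbitrarily many others. -/
inductive Error where
  | runTime
  | other (code : ℕ)

/-- The right-hand side of the recursive equation of guarded interaction trees, with negative
occurrences `X` and positive occurrences `Y` of the recursive type separated. -/
inductive ITF (E : Signature) (A X Y : Type) [COFE A] [COFE X] [COFE Y] : Type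
  | ret (a : A)
  | fn (g : ▶(X →ₙₑ Y))
  | err (e : Error)
  | tau (t : ▶Y)
  | vis (i : E.I) (x : (E.Ins i).obj X Y) (k : (E.Outs i).obj Y X →ₙₑ ▶Y)

section ITF

variable (E : Signature) (A : Type) [COFE A]

inductive ITF.Dist {E : Signature} {A X Y : Type} [COFE A] [COFE X] [COFE Y] (n : ℕ) :
    ITF E A X Y → ITF E A X Y → Prop
  | ret {a a'} (h : dist n a a') : ITF.Dist n (.ret a) (.ret a')
  | fn {g g'} (h : dist n g g') : ITF.Dist n (.fn g) (.fn g')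
  | err (e) : ITF.Dist n (.err e) (.err e)
  | tau {t t'} (h : dist n t t') : ITF.Dist n (.tau t) (.tau t')
  | vis (i) {x x' k k'} (h : dist n x x') (h' : dist n k k') :
      ITF.Dist n (.vis i x k) (.vis i x' k')

theorem ITF.complete {E : Signature} {A X Y : Type} [COFE A] [COFE X] [COFE Y]
    (c : ℕ → ITF E A X Y) (hc : ∀ n, ITF.Dist n (c n) (c (n + 1))) :
    ∃ l, ∀ n, ITF.Dist n (c n) l := by
  cases h0 : c 0 with
  | ret a =>
    have hs : ∀ n, ∃ x, c n = .ret x := by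
      intro n
      induction n with
      | zero => exact ⟨_, h0⟩
      | succ n ih =>
        obtain ⟨x, hx⟩ := ih
        have := hc n
        rw [hx] at this
        generalize c (n + 1) = z at this
        cases this
        exact ⟨_, rfl⟩
    choose d hd using hs
    obtain ⟨l, hl⟩ := COFE.complete d (fun n => by
      have := hc n
      rw [hd, hd] at this
      cases this
      assumption)
    exact ⟨.ret l, fun n => by rw [hd]; exact .ret (hl n)⟩
  | fn g =>
    have hs : ∀ n, ∃ x, c n = .fn x := by
      intro n
      induction n with
      | zero => exact ⟨_, h0⟩
      | succ n ih =>
        obtain ⟨x, hx⟩ := ih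
        have := hc n
        rw [hx] at this
        generalize c (n + 1) = z at this
        cases this
        exact ⟨_, rfl⟩
    choose d hd using hs
    obtain ⟨l, hl⟩ := COFE.complete d (fun n => by
      have := hc n
      rw [hd, hd] at this
      cases this
      assumption)
    exact ⟨.fn l, fun n => by rw [hd]; exact .fn (hl n)⟩
  | err e =>
    have hs : ∀ n, c n = .err e := by
      intro n
      induction n with
      | zero => exact h0
      | succ n ih =>
        have := hc n
        rw [ih] at this
        generalize c (n + 1) = z at this
        cases this
        rfl
    exact ⟨.err e, fun n => by rw [hs]; exact .err e⟩
  | tau t =>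
    have hs : ∀ n, ∃ x, c n = .tau x := by
      intro n
      induction n with
      | zero => exact ⟨_, h0⟩
      | succ n ih =>
        obtain ⟨x, hx⟩ := ih
        have := hc n
        rw [hx] at this
        generalize c (n + 1) = z at this
        cases this
        exact ⟨_, rfl⟩
    choose d hd using hs
    obtain ⟨l, hl⟩ := COFE.complete d (fun n => by
      have := hc n
      rw [hd, hd] at this
      cases this
      assumption)
    exact ⟨.tau l, fun n => by rw [hd]; exact .tau (hl n)⟩
  | vis i x k =>
    have hs : ∀ n, ∃ (x : (E.Ins i).obj X Y) (k : (E.Outs i).obj Y X →ₙₑ ▶Y),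
        c n = .vis i x k := by
      intro n
      induction n with
      | zero => exact ⟨_, _, h0⟩
      | succ n ih =>
        obtain ⟨x, k, hx⟩ := ih
        have := hc n
        rw [hx] at this
        generalize c (n + 1) = z at this
        cases this
        exact ⟨_, _, rfl⟩
    choose d e hd using hs
    have hde : ∀ n, dist n (d n) (d (n + 1)) ∧ dist n (e n) (e (n + 1)) := by
      intro n
      have := hc n
      rw [hd, hd] at this
      cases this
      exact ⟨by assumption, by assumption⟩
    obtain ⟨l, hl⟩ := COFE.complete d (fun n => (hde n).1)
    obtain ⟨r, hr⟩ := COFE.complete e (fun n => (hde n).2)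
    exact ⟨.vis i l r, fun n => by rw [hd]; exact .vis i (hl n) (hr n)⟩

instance {E : Signature} {A X Y : Type} [COFE A] [COFE X] [COFE Y] : COFE (ITF E A X Y) where
  dist := ITF.Dist
  dist_refl n x := by cases x <;> constructor <;> exact dist_refl _ _
  dist_symm h := by cases h <;> constructor <;> exact dist_symm ‹_›
  dist_trans h h' := by
    cases h with
    | ret h => cases h' with | ret h' => exact .ret (dist_trans h h')
    | fn h => cases h' with | fn h' => exact .fn (dist_trans h h')
    | err e => exact h'
    | tau h => cases h' with | tau h' => exact .tau (dist_trans h h')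
    | vis i h k => cases h' with | vis _ h' k' => exact .vis i (dist_trans h h') (dist_trans k k')
  dist_pred h := by cases h <;> constructor <;> exact dist_pred ‹_›
  eq_of_dist {x y} h := by
    cases h 0 with
    | ret => exact congrArg _ (eq_of_dist fun n => by cases h n; assumption)
    | fn => exact congrArg _ (eq_of_dist fun n => by cases h n; assumption)
    | err => rfl
    | tau => exact congrArg _ (eq_of_dist fun n => by cases h n; assumption)
    | @vis i x x' k k' =>
      have hx : x = x' := eq_of_dist fun n => by cases h n; assumption
      have hk : k = k' := eq_of_dist fun n => by cases h n; assumption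
      rw [hx, hk]
  complete := ITF.complete

def ITF.map {E : Signature} {A X X' Y Y' : Type} [COFE A] [COFE X] [COFE X'] [COFE Y] [COFE Y']
    (f : X' →ₙₑ X) (g : Y →ₙₑ Y') : ITF E A X Y → ITF E A X' Y'
  | .ret a => .ret a
  | .fn h => .fn (OFunctor.laterHom.map f g h)
  | .err e => .err e
  | .tau t => .tau (Later.map g t)
  | .vis i x k => .vis i ((E.Ins i).map f g x)
      (((Later.map g).comp k).comp ((E.Outs i).map g f))

/-- The functor of which guarded interaction trees are the fixed point. -/
def itFunctor : PointedFunctor where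
  obj X Y := ITF E A X Y
  inst _ _ := inferInstance
  map f g := ⟨ITF.map f g, fun h => by
    cases h with
    | ret h => exact .ret h
    | fn h => exact .fn ((OFunctor.laterHom.map f g).ne h)
    | err e => exact .err e
    | tau h => exact .tau ((Later.map g).ne h)
    | vis i h k => exact .vis i (((E.Ins i).map f g).ne h) (fun x => (Later.map g).ne (k _))⟩
  map_id z := by
    cases z with
    | ret a => rfl
    | fn h => rfl
    | err e => rfl
    | tau t => rfl
    | vis i x k => exact congrArg₂ _ ((E.Ins i).map_id x) (Hom.ext (funext fun y => by
        change Later.map (Hom.id _) (k ((E.Outs i).map _ _ y)) = k y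
        rw [(E.Outs i).map_id]; rfl))
  map_comp f f' g g' z := by
    cases z with
    | ret a => rfl
    | fn h => rfl
    | err e => rfl
    | tau t => rfl
    | vis i x k => exact congrArg₂ _ ((E.Ins i).map_comp _ _ _ _ x) (Hom.ext (funext fun y => by
        change Later.map g' (Later.map g (k ((E.Outs i).map _ _ ((E.Outs i).map _ _ y))))
          = Later.map (g'.comp g) (k ((E.Outs i).map _ _ y))
        rw [(E.Outs i).map_comp]; rfl))
  map_contractive h z := by
    cases z with
    | ret a => exact .ret (dist_refl _ _)
    | fn k => exact .fn (OFunctor.laterHom.map_contractive h k)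
    | err e => exact .err e
    | tau t => exact .tau (OFunctor.later.map_contractive h t)
    | vis i x k =>
      exact .vis i ((E.Ins i).map_contractive h x) (fun y =>
        dist_trans ((Later.map _).ne (k.ne ((E.Outs i).map_contractive
          (fun m hm => ⟨(h m hm).2, (h m hm).1⟩) y))) (OFunctor.later.map_contractive h _))
  pt _ _ := .err .runTime
  map_pt _ _ := rfl

end ITF

/-- The type of guarded interaction trees over the effect signature `E` and ground type `A`. -/
def IT (E : Signature) (A : Type) [COFE A] : Type := Limit (itFunctor E A)

section IT

variable {E : Signature} {A : Type} [COFE A]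

instance : COFE (IT E A) := inferInstanceAs (COFE (Limit (itFunctor E A)))

def IT.fold : ITF E A (IT E A) (IT E A) →ₙₑ IT E A := Limit.fold (itFunctor E A)

noncomputable def IT.unfold : IT E A →ₙₑ ITF E A (IT E A) (IT E A) := Limit.unfold (itFunctor E A)

theorem IT.fold_unfold (x : IT E A) : IT.fold (IT.unfold x) = x := Limit.fold_unfold _ x

theorem IT.unfold_fold (y : ITF E A (IT E A) (IT E A)) : IT.unfold (IT.fold y) = y :=
  Limit.unfold_fold (itFunctor E A) y

def Ret (a : A) : IT E A := IT.fold (.ret a)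

def Fun (g : ▶(IT E A →ₙₑ IT E A)) : IT E A := IT.fold (.fn g)

def Err (e : Error) : IT E A := IT.fold (.err e)

def Tau (t : ▶(IT E A)) : IT E A := IT.fold (.tau t)

def Vis (i : E.I) (x : (E.Ins i).obj (IT E A) (IT E A))
    (k : (E.Outs i).obj (IT E A) (IT E A) →ₙₑ ▶(IT E A)) : IT E A := IT.fold (.vis i x k)

def Tick (α : IT E A) : IT E A := Tau (.next α)

instance : Nonempty (IT E A) := ⟨Err .runTime⟩

instance {X Y : Type} [COFE X] [COFE Y] [Nonempty Y] : Nonempty (X →ₙₑ Y) :=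
  ⟨Hom.const (Classical.arbitrary Y)⟩

/-! ### Operations -/

/-- The body of the guarded recursive definition of `getval`. -/
noncomputable def getvalBody (self : ▶((IT E A →ₙₑ IT E A) →ₙₑ (IT E A →ₙₑ IT E A)))
    (f : IT E A →ₙₑ IT E A) (α : IT E A) : IT E A :=
  match IT.unfold α with
  | .ret a => f (Ret a)
  | .fn g => f (Fun g)
  | .err e => Err e
  | .tau t => Tau (.next (self.val f t.val))
  | .vis i x k => Vis i x ((Later.map (self.val f)).comp k)

theorem getvalBody_ne {n : ℕ} {s s' : ▶((IT E A →ₙₑ IT E A) →ₙₑ (IT E A →ₙₑ IT E A))}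
    {f f' : IT E A →ₙₑ IT E A} {α α' : IT E A} (hs : dist n s s') (hf : dist n f f')
    (hα : dist n α α') : dist n (getvalBody s f α) (getvalBody s' f' α') := by
  have h : ITF.Dist n (IT.unfold α) (IT.unfold α') := IT.unfold.ne hα
  unfold getvalBody
  revert h
  generalize IT.unfold α = z
  generalize IT.unfold α' = z'
  intro h
  cases h with
  | ret h => exact Hom.dist_app hf (IT.fold.ne (.ret h))
  | fn h => exact Hom.dist_app hf (IT.fold.ne (.fn h))
  | err e => exact dist_refl _ _
  | tau h => exact IT.fold.ne (.tau fun m hm =>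
      Hom.dist_app (Hom.dist_app (hs m hm) (dist_of_le hm.le hf)) (h m hm))
  | vis i h k => exact IT.fold.ne (.vis i h fun y m hm =>
      Hom.dist_app (Hom.dist_app (hs m hm) (dist_of_le hm.le hf)) (k y m hm))

/-- `getval f α` evaluates `α` to a value `Ret(a)` or `Fun(g)` and then calls `f` on it; `f` is
never applied to other trees. -/
noncomputable def getval : (IT E A →ₙₑ IT E A) →ₙₑ (IT E A →ₙₑ IT E A) :=
  fix ⟨fun self => Hom.mk₂ (getvalBody self) (getvalBody_ne (dist_refl _ _)),
    fun hs f α => getvalBody_ne hs (dist_refl _ f) (dist_refl _ α)⟩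

/-- On a value `Fun(g)`, proceed with `f(g)`; otherwise a runtime error. -/
noncomputable def onFun : (▶(IT E A →ₙₑ IT E A) →ₙₑ IT E A) →ₙₑ (IT E A →ₙₑ IT E A) :=
  Hom.mk₂ (fun f α => match IT.unfold α with
    | .fn g => f g
    | _ => Err .runTime) (by
    intro n f f' α α' hf hα
    have h : ITF.Dist n (IT.unfold α) (IT.unfold α') := IT.unfold.ne hα
    revert h
    generalize IT.unfold α = z
    generalize IT.unfold α' = z'
    intro h
    cases h with
    | fn h => exact Hom.dist_app hf h
    | _ => exact dist_refl _ _)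

/-- `getfun f α` evaluates `α` to a value `Fun(g)` and proceeds with `f(g)`. -/
noncomputable def getfun : (▶(IT E A →ₙₑ IT E A) →ₙₑ IT E A) →ₙₑ (IT E A →ₙₑ IT E A) :=
  getval.comp onFun

/-- Call-by-value application: evaluate the argument, then the function, then call. -/
noncomputable def APP : IT E A →ₙₑ (IT E A →ₙₑ IT E A) :=
  Hom.mk₂ (fun α β => getval
      (Hom.mk₂ (fun α' βv => getfun
        (⟨fun g => Tau (Later.ap g (.next βv)),
          fun h => IT.fold.ne (.tau (Later.dist_ap h (dist_refl _ _)))⟩) α')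
        (fun hα hβ => Hom.dist_app (getfun.ne fun _ =>
          IT.fold.ne (.tau (Later.dist_ap (dist_refl _ _) fun _ hm => dist_of_le hm.le hβ))) hα) α)
      β)
    (fun hα hβ => Hom.dist_app (getval.ne (Hom.ne _ hα)) hβ)

end IT

/-! ### Operations on trees whose ground type includes the natural numbers -/

section Nat

variable {E : Signature} {B : Type} [COFE B]

/-- On a value `Ret(n)` with `n` a natural number, proceed with `f(n)`; otherwise a runtime
error. -/
noncomputable def onNat : (ℕ → IT E (ℕ ⊕ B)) →ₙₑ (IT E (ℕ ⊕ B) →ₙₑ IT E (ℕ ⊕ B)) :=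
  Hom.mk₂ (fun f α => match IT.unfold α with
    | .ret (.inl n) => f n
    | _ => Err .runTime) (by
    intro n f f' α α' hf hα
    have h : ITF.Dist n (IT.unfold α) (IT.unfold α') := IT.unfold.ne hα
    revert h
    generalize IT.unfold α = z
    generalize IT.unfold α' = z'
    intro h
    cases h with
    | ret h =>
      cases h with
      | inl h => cases h; exact hf _
      | inr h => exact dist_refl _ _
    | _ => exact dist_refl _ _)

/-- `NATOP op α β` evaluates `β` and then `α` to values and applies `op` to them. -/
noncomputable def NATOP (op : ℕ → ℕ → ℕ) :
    IT E (ℕ ⊕ B) →ₙₑ (IT E (ℕ ⊕ B) →ₙₑ IT E (ℕ ⊕ B)) :=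
  Hom.mk₂ (fun α β => getval
      (Hom.mk₂ (fun α' βv => getval
        (⟨fun αv => onNat (fun m => onNat (fun n => Ret (.inl (op n m))) αv) βv,
          fun h => Hom.dist_app (onNat.ne fun _ => Hom.ne _ h) (dist_refl _ _)⟩) α')
        (fun hα hβ => Hom.dist_app (getval.ne fun _ => (onNat _).ne hβ) hα) α)
      β)
    (fun hα hβ => Hom.dist_app (getval.ne (Hom.ne _ hα)) hβ)

/-- The conditional: evaluate `α` to a natural number; `β₁` if it is non-zero, else `β₂`. -/
noncomputable def IF (α β₁ β₂ : IT E (ℕ ⊕ B)) : IT E (ℕ ⊕ B) :=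
  getval (onNat (fun n => if n = 0 then β₂ else β₁)) α

theorem IF_ne {n : ℕ} {α α' β₁ β₁' β₂ β₂' : IT E (ℕ ⊕ B)} (h : dist n α α')
    (h₁ : dist n β₁ β₁') (h₂ : dist n β₂ β₂') : dist n (IF α β₁ β₂) (IF α' β₁' β₂') := by
  refine Hom.dist_app (getval.ne (onNat.ne fun k => ?_)) h
  by_cases hk : k = 0
  · simpa [hk] using h₂
  · simpa [hk] using h₁

end Nat

/-! ### Context-dependent reifiers and reduction -/

/-- Context-dependent reifiers: from the input of the effect, the state and the current
continuation, compute the next tree and the new state, or fail. -/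
structure Reifier (E : Signature) (A : Type) [COFE A] where
  State : Type
  inst : COFE State
  r : (i : E.I) → (E.Ins i).obj (IT E A) (IT E A) × State ×
      ((E.Outs i).obj (IT E A) (IT E A) →ₙₑ ▶(IT E A)) →ₙₑ Option (▶(IT E A) × State)

attribute [instance] Reifier.inst

section Reduction

variable {E : Signature} {A : Type} [COFE A]

/-- Reify the top-level effect of a tree; a tree without one is left alone. -/
noncomputable def reify (R : Reifier E A) (c : IT E A × R.State) : IT E A × R.State :=
  match IT.unfold c.1 with
  | .vis i x κ =>
    match R.r i (x, c.2, κ) with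
    | some (β, σ') => (Tau β, σ')
    | none => (Err .runTime, c.2)
  | _ => c

/-- The reduction relation `(α, σ) ⤳ (β, σ')`. -/
def IStep (R : Reifier E A) (c d : IT E A × R.State) : Prop :=
  (c.1 = Tick d.1 ∧ c.2 = d.2) ∨
    ∃ i x k, c.1 = Vis i x k ∧ reify R c = (Tick d.1, d.2)

/-- The reflexive transitive closure `⤳*` of the reduction relation. -/
def ISteps (R : Reifier E A) : IT E A × R.State → IT E A × R.State → Prop :=
  Relation.ReflTransGen (IStep R)

end Reduction

end GITree

/-! # The call/cc language -/

namespace CallCC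

/-! ### Terms and operational semantics

Variables are de Bruijn indices. `rec e` stands for `rec f x = e` and binds `x` as index 0 and
`f` as index 1; `callcc e` binds the continuation as index 0. Binary operations on natural
numbers are arbitrary functions `op`. -/

mutual
  inductive Expr : Type
    | val (v : Val)
    | var (x : ℕ)
    | app (e₁ e₂ : Expr)
    | natop (op : ℕ → ℕ → ℕ) (e₁ e₂ : Expr)
    | ite (e₁ e₂ e₃ : Expr)
    | callcc (e : Expr)
    | throw (e₁ e₂ : Expr)
  inductive Val : Type
    | nat (n : ℕ)
    | recv (e : Expr)
    | cont (K : Ectx)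
  inductive Ectx : Type
    | empty
    | ite (K : Ectx) (e₁ e₂ : Expr)
    | appL (K : Ectx) (v : Val)
    | appR (e : Expr) (K : Ectx)
    | natopR (op : ℕ → ℕ → ℕ) (e : Expr) (K : Ectx)
    | natopL (op : ℕ → ℕ → ℕ) (K : Ectx) (v : Val)
    | throwL (K : Ectx) (e : Expr)
    | throwR (v : Val) (K : Ectx)
end

/-- Lift a renaming under one binder. -/
def upr (ξ : ℕ → ℕ) : ℕ → ℕ
  | 0 => 0
  | n + 1 => ξ n + 1

mutual
  def Expr.rename (ξ : ℕ → ℕ) : Expr → Expr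
    | .val v => .val (v.rename ξ)
    | .var x => .var (ξ x)
    | .app e₁ e₂ => .app (e₁.rename ξ) (e₂.rename ξ)
    | .natop op e₁ e₂ => .natop op (e₁.rename ξ) (e₂.rename ξ)
    | .ite e₁ e₂ e₃ => .ite (e₁.rename ξ) (e₂.rename ξ) (e₃.rename ξ)
    | .callcc e => .callcc (e.rename (upr ξ))
    | .throw e₁ e₂ => .throw (e₁.rename ξ) (e₂.rename ξ)
  def Val.rename (ξ : ℕ → ℕ) : Val → Val
    | .nat n => .nat n
    | .recv e => .recv (e.rename (upr (upr ξ)))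
    | .cont K => .cont (K.rename ξ)
  def Ectx.rename (ξ : ℕ → ℕ) : Ectx → Ectx
    | .empty => .empty
    | .ite K e₁ e₂ => .ite (K.rename ξ) (e₁.rename ξ) (e₂.rename ξ)
    | .appL K v => .appL (K.rename ξ) (v.rename ξ)
    | .appR e K => .appR (e.rename ξ) (K.rename ξ)
    | .natopR op e K => .natopR op (e.rename ξ) (K.rename ξ)
    | .natopL op K v => .natopL op (K.rename ξ) (v.rename ξ)
    | .throwL K e => .throwL (K.rename ξ) (e.rename ξ)
    | .throwR v K => .throwR (v.rename ξ) (K.rename ξ)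
end

/-- Lift a substitution under one binder. -/
def ups (s : ℕ → Expr) : ℕ → Expr
  | 0 => .var 0
  | n + 1 => (s n).rename Nat.succ

mutual
  def Expr.subst (s : ℕ → Expr) : Expr → Expr
    | .val v => .val (v.subst s)
    | .var x => s x
    | .app e₁ e₂ => .app (e₁.subst s) (e₂.subst s)
    | .natop op e₁ e₂ => .natop op (e₁.subst s) (e₂.subst s)
    | .ite e₁ e₂ e₃ => .ite (e₁.subst s) (e₂.subst s) (e₃.subst s)
    | .callcc e => .callcc (e.subst (ups s))
    | .throw e₁ e₂ => .throw (e₁.subst s) (e₂.subst s)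
  def Val.subst (s : ℕ → Expr) : Val → Val
    | .nat n => .nat n
    | .recv e => .recv (e.subst (ups (ups s)))
    | .cont K => .cont (K.subst s)
  def Ectx.subst (s : ℕ → Expr) : Ectx → Ectx
    | .empty => .empty
    | .ite K e₁ e₂ => .ite (K.subst s) (e₁.subst s) (e₂.subst s)
    | .appL K v => .appL (K.subst s) (v.subst s)
    | .appR e K => .appR (e.subst s) (K.subst s)
    | .natopR op e K => .natopR op (e.subst s) (K.subst s)
    | .natopL op K v => .natopL op (K.subst s) (v.subst s)
    | .throwL K e => .throwL (K.subst s) (e.subst s)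
    | .throwR v K => .throwR (v.subst s) (K.subst s)
end

/-- The substitution of `v` for index 0, which decrements the other indices. -/
def single (v : Val) : ℕ → Expr
  | 0 => .val v
  | n + 1 => .var n

/-- The substitution of `v₀` for index 0 and of `v₁` for index 1. -/
def double (v₀ v₁ : Val) : ℕ → Expr
  | 0 => .val v₀
  | 1 => .val v₁
  | n + 2 => .var n

/-- `K.plug e` is `K[e]`. -/
def Ectx.plug : Ectx → Expr → Expr
  | .empty, e => e
  | .ite K e₁ e₂, e => .ite (K.plug e) e₁ e₂
  | .appL K v, e => .app (K.plug e) (.val v)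
  | .appR e' K, e => .app e' (K.plug e)
  | .natopR op e' K, e => .natop op e' (K.plug e)
  | .natopL op K v, e => .natop op (K.plug e) (.val v)
  | .throwL K e', e => .throw (K.plug e) e'
  | .throwR v K, e => .throw (.val v) (K.plug e)

/-- Local (head) reductions of primitive expressions, in the evaluation context `K`. -/
inductive LocalStep (K : Ectx) : Expr → Expr → Prop
  | beta (e : Expr) (v : Val) :
      LocalStep K (.app (.val (.recv e)) (.val v)) (e.subst (double v (.recv e)))
  | natop (op : ℕ → ℕ → ℕ) (n m : ℕ) :
      LocalStep K (.natop op (.val (.nat n)) (.val (.nat m))) (.val (.nat (op n m)))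
  | iteTrue (n : ℕ) (e₁ e₂ : Expr) (h : n ≠ 0) : LocalStep K (.ite (.val (.nat n)) e₁ e₂) e₁
  | iteFalse (e₁ e₂ : Expr) : LocalStep K (.ite (.val (.nat 0)) e₁ e₂) e₂
  | callcc (e : Expr) : LocalStep K (.callcc e) (e.subst (single (.cont K)))

/-- One-step reduction of complete programs. -/
inductive Step : Expr → Expr → Prop
  | plug (K : Ectx) {e₁ e₂ : Expr} (h : LocalStep K e₁ e₂) : Step (K.plug e₁) (K.plug e₂)
  | throw (K K' : Ectx) (v : Val) :
      Step (K.plug (.throw (.val v) (.val (.cont K')))) (K'.plug (.val v))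

/-! ### Effects -/

open GITree GITree.COFE

inductive Op where
  | callcc
  | throw

/-- The effect signature: `callcc` has input arity `(▶X → ▶X) → ▶X` and output arity `▶X`;
`throw` has input arity `▶X × ▶(X → X)` and output arity `0`. -/
def sig : Signature where
  I := Op
  Ins
    | .callcc => .hom (.hom .later .later) .later
    | .throw => .prod .later .laterHom
  Outs
    | .callcc => .later
    | .throw => .empty

section Semantics

variable {B : Type} [COFE B]

/-- Guarded interaction trees for the language, over a ground type that includes the natural
numbers. -/
abbrev Tree (B : Type) [COFE B] : Type := IT sig (ℕ ⊕ B)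

def CALLCC (f : (▶(Tree B) →ₙₑ ▶(Tree B)) →ₙₑ ▶(Tree B)) : Tree B :=
  Vis (E := sig) .callcc f (Hom.id ▶(Tree B))

def THROW (e : ▶(Tree B)) (f : ▶(Tree B →ₙₑ Tree B)) : Tree B :=
  Vis (E := sig) .throw (e, f) (Hom.elim ▶(Tree B))

theorem CALLCC_ne {n : ℕ} {f f' : (▶(Tree B) →ₙₑ ▶(Tree B)) →ₙₑ ▶(Tree B)} (h : dist n f f') :
    dist n (CALLCC f) (CALLCC f') := IT.fold.ne (.vis (E := sig) Op.callcc h (dist_refl _ _))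

theorem THROW_ne {n : ℕ} {e e' : ▶(Tree B)} {f f' : ▶(Tree B →ₙₑ Tree B)} (he : dist n e e')
    (hf : dist n f f') : dist n (THROW e f) (THROW e' f') :=
  IT.fold.ne (.vis (E := sig) Op.throw ⟨he, hf⟩ (dist_refl _ _))

/-- `r_callcc(f, (), κ) = Some(κ (f κ), ())`. -/
def reifyCallcc : ((▶(Tree B) →ₙₑ ▶(Tree B)) →ₙₑ ▶(Tree B)) × Unit × (▶(Tree B) →ₙₑ ▶(Tree B)) →ₙₑ
    Option (▶(Tree B) × Unit) where
  toFun p := some (p.2.2 (p.1 p.2.2), ())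
  ne h := .some ⟨Hom.dist_app h.2.2 (Hom.dist_app h.1 h.2.2), rfl⟩

/-- `r_throw((α, f), (), κ) = Some(f α, ())`. -/
def reifyThrow : (▶(Tree B) × ▶(Tree B →ₙₑ Tree B)) × Unit × (Empty →ₙₑ ▶(Tree B)) →ₙₑ
    Option (▶(Tree B) × Unit) where
  toFun p := some (Later.ap p.1.2 p.1.1, ())
  ne h := .some ⟨Later.dist_ap h.1.2 h.1.1, rfl⟩

/-- The context-dependent reifiers of the language, with trivial state. -/
def reifier (B : Type) [COFE B] : Reifier sig (ℕ ⊕ B) where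
  State := Unit
  inst := inferInstance
  r
    | .callcc => reifyCallcc
    | .throw => reifyThrow

/-! ### Denotational semantics -/

/-- Environments. -/
abbrev Env (B : Type) [COFE B] : Type := ℕ → Tree B

/-- Extension of an environment by a new variable with index 0. -/
def extend (ρ : Env B) (α : Tree B) : Env B
  | 0 => α
  | n + 1 => ρ n

theorem extend_ne {n : ℕ} {ρ ρ' : Env B} {α α' : Tree B} (hρ : dist n ρ ρ') (hα : dist n α α') :
    dist n (extend ρ α) (extend ρ' α')
  | 0 => hα
  | k + 1 => hρ k

/-- `getval(α, λ x. getfun(β, λ f. THROW(Next x, f)))`. -/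
noncomputable def throwTree : Tree B →ₙₑ (Tree B →ₙₑ Tree B) :=
  Hom.mk₂ (fun α β => getval
      (Hom.mk₂ (fun β' x => getfun
        (⟨fun f => THROW (.next x) f, fun h => THROW_ne (dist_refl _ _) h⟩) β')
        (fun hβ hx => Hom.dist_app (getfun.ne fun _ =>
          THROW_ne (fun _ hm => dist_of_le hm.le hx) (dist_refl _ _)) hβ) β)
      α)
    (fun hα hβ => Hom.dist_app (getval.ne (Hom.ne _ hβ)) hα)

/-- `Fun(Next(λ y. Tau(f(Next y))))`. -/
def reflectFun (f : ▶(Tree B) →ₙₑ ▶(Tree B)) : Tree B :=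
  Fun (.next ⟨fun y => Tau (f (.next y)),
    fun h => IT.fold.ne (.tau (f.ne fun _ hm => dist_of_le hm.le h))⟩)

theorem reflectFun_ne {n : ℕ} {f f' : ▶(Tree B) →ₙₑ ▶(Tree B)} (h : dist n f f') :
    dist n (reflectFun f) (reflectFun f') :=
  IT.fold.ne (.fn fun _ hm y => IT.fold.ne (.tau (dist_of_le hm.le (h (.next y)))))

/-- The denotation of `callcc x. e` from that of `e`. -/
def callccDen (e : Env B →ₙₑ Tree B) : Env B →ₙₑ Tree B where
  toFun ρ := CALLCC ⟨fun f => .next (e (extend ρ (reflectFun f))),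
    fun h _ hm => e.ne (extend_ne (dist_refl _ _) (reflectFun_ne (dist_of_le hm.le h)))⟩
  ne h := CALLCC_ne fun _ _ hm => e.ne (extend_ne (dist_of_le hm.le h) (dist_refl _ _))

/-- The denotation of `rec f x = e` from that of `e`: the guarded fixed point
`self ρ = Fun(Next(λ a. e(ρ[f ↦ self ρ, x ↦ a])))`. -/
noncomputable def recDen (e : Env B →ₙₑ Tree B) : Env B →ₙₑ Tree B :=
  fix ⟨fun self => ⟨fun ρ => Fun (.next ⟨fun a => e (extend (extend ρ (self.val ρ)) a),
      fun h => e.ne (extend_ne (dist_refl _ _) h)⟩),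
    fun h => IT.fold.ne (.fn fun _ hm _ => e.ne (extend_ne (extend_ne (dist_of_le hm.le h)
      (self.val.ne (dist_of_le hm.le h))) (dist_refl _ _)))⟩,
  fun {_ s s'} (h : dist _ s s') ρ => IT.fold.ne (.fn fun m hm _ => e.ne (extend_ne (extend_ne (dist_refl _ _)
      (h m hm ρ)) (dist_refl _ _)))⟩

/-- The denotation of `cont K` from that of `K`: `Fun(Next(λ x. Tau((▶K)(Next x))))`. -/
def contDen (K : Env B →ₙₑ (Tree B →ₙₑ Tree B)) : Env B →ₙₑ Tree B where
  toFun ρ := reflectFun (Later.map (K ρ))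
  ne h := reflectFun_ne fun x _ hm => dist_of_le hm.le (K.ne h x.val)

mutual
  /-- Denotations of expressions. -/
  noncomputable def Expr.den : Expr → (Env B →ₙₑ Tree B)
    | .val v => v.den
    | .var x => ⟨fun ρ => ρ x, fun h => h x⟩
    | .app e₁ e₂ => ⟨fun ρ => APP (e₁.den ρ) (e₂.den ρ),
        fun h => Hom.dist_app (APP.ne (e₁.den.ne h)) (e₂.den.ne h)⟩
    | .natop op e₁ e₂ => ⟨fun ρ => NATOP op (e₁.den ρ) (e₂.den ρ),
        fun h => Hom.dist_app ((NATOP op).ne (e₁.den.ne h)) (e₂.den.ne h)⟩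
    | .ite e₁ e₂ e₃ => ⟨fun ρ => IF (e₁.den ρ) (e₂.den ρ) (e₃.den ρ),
        fun h => IF_ne (e₁.den.ne h) (e₂.den.ne h) (e₃.den.ne h)⟩
    | .callcc e => callccDen e.den
    | .throw e₁ e₂ => ⟨fun ρ => throwTree (e₁.den ρ) (e₂.den ρ),
        fun h => Hom.dist_app (throwTree.ne (e₁.den.ne h)) (e₂.den.ne h)⟩
  /-- Denotations of values. -/
  noncomputable def Val.den : Val → (Env B →ₙₑ Tree B)
    | .nat n => Hom.const (Ret (.inl n))
    | .recv e => recDen e.den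
    | .cont K => contDen K.den
  /-- Denotations of evaluation contexts. -/
  noncomputable def Ectx.den : Ectx → (Env B →ₙₑ (Tree B →ₙₑ Tree B))
    | .empty => Hom.const (Hom.id _)
    | .ite K e₁ e₂ => Hom.mk₂ (fun ρ x => IF (K.den ρ x) (e₁.den ρ) (e₂.den ρ))
        (fun h hx => IF_ne (Hom.dist_app (K.den.ne h) hx) (e₁.den.ne h) (e₂.den.ne h))
    | .appL K v => Hom.mk₂ (fun ρ x => APP (K.den ρ x) (v.den ρ))
        (fun h hx => Hom.dist_app (APP.ne (Hom.dist_app (K.den.ne h) hx)) (v.den.ne h))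
    | .appR e K => Hom.mk₂ (fun ρ x => APP (e.den ρ) (K.den ρ x))
        (fun h hx => Hom.dist_app (APP.ne (e.den.ne h)) (Hom.dist_app (K.den.ne h) hx))
    | .natopR op e K => Hom.mk₂ (fun ρ x => NATOP op (e.den ρ) (K.den ρ x))
        (fun h hx => Hom.dist_app ((NATOP op).ne (e.den.ne h)) (Hom.dist_app (K.den.ne h) hx))
    | .natopL op K v => Hom.mk₂ (fun ρ x => NATOP op (K.den ρ x) (v.den ρ))
        (fun h hx => Hom.dist_app ((NATOP op).ne (Hom.dist_app (K.den.ne h) hx)) (v.den.ne h))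
    | .throwL K e => Hom.mk₂ (fun ρ x => throwTree (K.den ρ x) (e.den ρ))
        (fun h hx => Hom.dist_app (throwTree.ne (Hom.dist_app (K.den.ne h) hx)) (e.den.ne h))
    | .throwR v K => Hom.mk₂ (fun ρ x => throwTree (v.den ρ) (K.den ρ x))
        (fun h hx => Hom.dist_app (throwTree.ne (v.den.ne h)) (Hom.dist_app (K.den.ne h) hx))
end

end Semantics

end CallCC

-- The key fact is that every evaluation context `K` denotes a homomorphism: a map on trees that
-- commutes with `Tau` and with `Vis` (`Ectx.isHomomorphism_den`). Each context frame is, as a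
-- function of its hole, of the form `getval f` for an `f` that does not depend on the hole, and
-- `getval f` commutes with `Tau` and `Vis` by its defining clauses. Homomorphisms compose, so
-- induction on `K` suffices.
--
-- Since `K[e]` denotes the map of `K` applied to the tree of `e` (`Ectx.den_plug`), it remains to
-- follow the tree of the redex through a homomorphism. A beta redex is a `Tick` of its contractum,
-- and the tick passes through `K` and is consumed by one reduction. Arithmetic and conditionals
-- denote the same tree before and after, so no reduction is needed.
--
-- For `callcc`, commuting with `Vis` turns the identity continuation into `▶K`. The reifier
-- therefore passes exactly `▶K` to the body, where it is reflected as the denotation of `cont K`,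
-- and resumes the result in `K`. For `throw`, the surrounding context is absorbed into a
-- continuation that the reifier ignores, and the thrown-to function costs one further tick, which
-- gives two reductions.
--
-- Beta and `callcc` also need the semantic substitution lemma (`Expr.den_subst`). Its case for
-- `rec` compares two guarded fixed points and is proved by induction on the step index
-- (`recDen_congr`).

namespace GITree

open COFE

-- Computation rules for trees, `getval` and `getfun`.

section Unfold

variable {E : Signature} {A : Type} [COFE A]

/-- `IT.unfold` is obtained by choice and does not compute. This equation and its three companions
are what lets a `match` on an unfolded tree reduce. -/
theorem unfold_Ret (a : A) : IT.unfold (Ret (E := E) a) = .ret a := IT.unfold_fold _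

theorem unfold_Fun (g : ▶(IT E A →ₙₑ IT E A)) : IT.unfold (Fun g) = .fn g := IT.unfold_fold _

theorem unfold_Tau (t : ▶(IT E A)) : IT.unfold (Tau t) = .tau t := IT.unfold_fold _

theorem unfold_Vis (i : E.I) (x : (E.Ins i).obj (IT E A) (IT E A))
    (k : (E.Outs i).obj (IT E A) (IT E A) →ₙₑ ▶(IT E A)) :
    IT.unfold (Vis i x k) = .vis i x k := IT.unfold_fold _

/-- The fixed-point equation of `fix` is only propositional. It is stated here after application to
both arguments, so that the clauses for the constructors follow by rewriting. -/
theorem getval_eq (f : IT E A →ₙₑ IT E A) (α : IT E A) :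
    getval f α = getvalBody (.next getval) f α :=
  (congrArg (fun g : (IT E A →ₙₑ IT E A) →ₙₑ (IT E A →ₙₑ IT E A) => g f α) (fix_eq _)).symm

theorem getval_Ret (f : IT E A →ₙₑ IT E A) (a : A) : getval f (Ret a) = f (Ret a) := by
  rw [getval_eq, getvalBody, unfold_Ret]

theorem getval_Fun (f : IT E A →ₙₑ IT E A) (g : ▶(IT E A →ₙₑ IT E A)) :
    getval f (Fun g) = f (Fun g) := by
  rw [getval_eq, getvalBody, unfold_Fun]

theorem getval_Tau (f : IT E A →ₙₑ IT E A) (t : ▶(IT E A)) :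
    getval f (Tau t) = Tau (Later.map (getval f) t) := by
  rw [getval_eq, getvalBody, unfold_Tau]
  rfl

theorem getval_Vis (f : IT E A →ₙₑ IT E A) (i : E.I) (x : (E.Ins i).obj (IT E A) (IT E A))
    (k : (E.Outs i).obj (IT E A) (IT E A) →ₙₑ ▶(IT E A)) :
    getval f (Vis i x k) = Vis i x ((Later.map (getval f)).comp k) := by
  rw [getval_eq, getvalBody, unfold_Vis]

theorem getfun_Fun (f : ▶(IT E A →ₙₑ IT E A) →ₙₑ IT E A) (g : ▶(IT E A →ₙₑ IT E A)) :
    getfun f (Fun g) = f g := by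
  change getval (onFun f) (Fun g) = f g
  rw [getval_Fun]
  -- The `match` is hidden inside the non-expansive map `onFun f`; it is exposed so that its
  -- discriminant can be rewritten.
  change (match IT.unfold (Fun g) with
    | .fn g => f g
    | _ => Err .runTime) = f g
  rw [unfold_Fun]

theorem onNat_Ret {B : Type} [COFE B] (f : ℕ → IT E (ℕ ⊕ B)) (n : ℕ) :
    onNat f (Ret (.inl n)) = f n := by
  change (match IT.unfold (Ret (E := E) (A := ℕ ⊕ B) (.inl n)) with
    | .ret (.inl n) => f n
    | _ => Err .runTime) = f n
  rw [unfold_Ret]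

-- Homomorphisms and values.

/-- Maps that commute with computation steps and effects. -/
structure IsHomomorphism (h : IT E A →ₙₑ IT E A) : Prop where
  map_Tau : ∀ t, h (Tau t) = Tau (Later.map h t)
  map_Vis : ∀ i x k, h (Vis i x k) = Vis i x ((Later.map h).comp k)

theorem IsHomomorphism.id : IsHomomorphism (Hom.id (IT E A)) := ⟨fun _ => rfl, fun _ _ _ => rfl⟩

/-- This is the induction step for contexts: `getval f` propagates through `Tau` and `Vis`, so
postcomposing with it preserves homomorphisms. It is essential that `f` is the same for all `α`. The
factorisation is asked for pointwise because for some frames it is a proved equation and not a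
definitional one. -/
theorem IsHomomorphism.of_getval {f h h' : IT E A →ₙₑ IT E A} (hh : IsHomomorphism h)
    (e : ∀ α, h' α = getval f (h α)) : IsHomomorphism h' where
  map_Tau t := by
    obtain rfl : h' = (getval f).comp h := Hom.ext (funext e)
    rw [e, hh.map_Tau, getval_Tau]
    rfl
  map_Vis i x k := by
    obtain rfl : h' = (getval f).comp h := Hom.ext (funext e)
    rw [e, hh.map_Vis, getval_Vis]
    rfl

/-- Trees that are values. -/
inductive IsValue : IT E A → Prop
  | ret (a : A) : IsValue (Ret a)
  | fn (g : ▶(IT E A →ₙₑ IT E A)) : IsValue (Fun g)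

theorem IsValue.getval {α : IT E A} (h : IsValue α) (f : IT E A →ₙₑ IT E A) :
    getval f α = f α := by
  cases h
  · exact getval_Ret _ _
  · exact getval_Fun _ _

/-- `APP` evaluates its argument first, so it calls `g` at once only when that argument is already a
value. -/
theorem APP_Fun (g : ▶(IT E A →ₙₑ IT E A)) {β : IT E A} (h : IsValue β) :
    APP (Fun g) β = Tau (Later.ap g (.next β)) :=
  (h.getval _).trans (getfun_Fun _ _)

theorem NATOP_Ret {B : Type} [COFE B] (op : ℕ → ℕ → ℕ) (n m : ℕ) :
    NATOP op (Ret (E := E) (A := ℕ ⊕ B) (.inl n)) (Ret (.inl m)) = Ret (.inl (op n m)) :=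
  (getval_Ret _ _).trans ((getval_Ret _ _).trans ((onNat_Ret _ _).trans (onNat_Ret _ _)))

theorem IF_Ret {B : Type} [COFE B] (n : ℕ) (β₁ β₂ : IT E (ℕ ⊕ B)) :
    IF (Ret (.inl n)) β₁ β₂ = if n = 0 then β₂ else β₁ :=
  (getval_Ret _ _).trans (onNat_Ret _ _)

-- Single reductions.

theorem ISteps.tick (R : Reifier E A) (α : IT E A) (σ : R.State) :
    ISteps R (Tick α, σ) (α, σ) := .single (.inl ⟨rfl, rfl⟩)

theorem ISteps.vis (R : Reifier E A) {i x k σ σ'} {β : IT E A}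
    (h : R.r i (x, σ, k) = some (.next β, σ')) : ISteps R (Vis i x k, σ) (β, σ') := by
  refine .single (.inr ⟨i, x, k, rfl, ?_⟩)
  rw [reify]
  simp only [unfold_Vis, h]
  -- By definition `Tau (.next β)` is `Tick β`, the form that the reduction relation asks of the
  -- reified tree.
  rfl

end Unfold

end GITree

namespace CallCC

open GITree GITree.COFE

-- Congruence of the binding constructs.

variable {B : Type} [COFE B]

theorem recDen_eq (e : Env B →ₙₑ Tree B) (ρ : Env B) :
    recDen e ρ = Fun (.next ⟨fun a => e (extend (extend ρ (recDen e ρ)) a),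
      fun h => e.ne (extend_ne (dist_refl _ _) h)⟩) :=
  (congrArg (fun g : Env B →ₙₑ Tree B => g ρ) (fix_eq _)).symm

/-- Two guarded fixed points agree when their bodies do, although the recursive values stored in the
two environments are not yet known to agree. Both sides are `Fun` of a delayed map, so agreement at
index `n` needs agreement of the bodies only at indices `m < n`, where strong induction already
identifies the recursive values. -/
theorem recDen_congr {e e' : Env B →ₙₑ Tree B} {ρ ρ' : Env B}
    (h : ∀ α β, e (extend (extend ρ α) β) = e' (extend (extend ρ' α) β)) :
    recDen e ρ = recDen e' ρ' := by
  refine eq_of_dist fun n => ?_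
  induction n using Nat.strong_induction_on with
  | _ n ih =>
    rw [recDen_eq e, recDen_eq e']
    refine IT.fold.ne (.fn fun m hm a => ?_)
    change dist m (e _) (e' _)
    -- This exchanges `e` for `e'` while keeping `recDen e ρ` as the recursive entry. The entry is
    -- then exchanged up to index `m` by non-expansiveness of `e'`.
    rw [h]
    exact e'.ne (extend_ne (extend_ne (dist_refl _ _) (ih m hm)) (dist_refl _ _))

theorem callccDen_congr {e e' : Env B →ₙₑ Tree B} {ρ ρ' : Env B}
    (h : ∀ α, e (extend ρ α) = e' (extend ρ' α)) : callccDen e ρ = callccDen e' ρ' :=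
  congrArg CALLCC (Hom.ext (funext fun f => congrArg Later.next (h (reflectFun f))))

-- Renaming and substitution lemmas.

theorem extend_upr (ξ : ℕ → ℕ) (ρ : Env B) (α : Tree B) :
    (fun x => extend ρ α (upr ξ x)) = extend (fun x => ρ (ξ x)) α := by
  funext x
  cases x <;> rfl

-- Renaming comes before substitution because lifting a substitution under a binder weakens the
-- substituted terms. The induction is mutual over all three sorts because `cont K` makes contexts
-- part of values.
mutual
  theorem Expr.den_rename : ∀ (e : Expr) (ξ : ℕ → ℕ) (ρ : Env B),
      (e.rename ξ).den ρ = e.den (fun x => ρ (ξ x))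
    | .val v, ξ, ρ => by
      simp only [Expr.rename, Expr.den]
      exact v.den_rename ξ ρ
    | .var x, ξ, ρ => by simp only [Expr.rename, Expr.den]
    | .app e₁ e₂, ξ, ρ => by
      simp only [Expr.rename, Expr.den, e₁.den_rename ξ ρ, e₂.den_rename ξ ρ]
    | .natop op e₁ e₂, ξ, ρ => by
      simp only [Expr.rename, Expr.den, e₁.den_rename ξ ρ, e₂.den_rename ξ ρ]
    | .ite e₁ e₂ e₃, ξ, ρ => by
      simp only [Expr.rename, Expr.den, e₁.den_rename ξ ρ, e₂.den_rename ξ ρ, e₃.den_rename ξ ρ]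
    | .callcc e, ξ, ρ => by
      simp only [Expr.rename, Expr.den]
      exact callccDen_congr fun α => by rw [e.den_rename, extend_upr]
    | .throw e₁ e₂, ξ, ρ => by
      simp only [Expr.rename, Expr.den, e₁.den_rename ξ ρ, e₂.den_rename ξ ρ]
  theorem Val.den_rename : ∀ (v : Val) (ξ : ℕ → ℕ) (ρ : Env B),
      (v.rename ξ).den ρ = v.den (fun x => ρ (ξ x))
    | .nat n, ξ, ρ => by
      simp only [Val.rename, Val.den]
      rfl
    | .recv e, ξ, ρ => by
      simp only [Val.rename, Val.den]
      exact recDen_congr fun α β => by rw [e.den_rename, extend_upr, extend_upr]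
    | .cont K, ξ, ρ => by
      simp only [Val.rename, Val.den, contDen, K.den_rename ξ ρ]
  theorem Ectx.den_rename : ∀ (K : Ectx) (ξ : ℕ → ℕ) (ρ : Env B),
      (K.rename ξ).den ρ = K.den (fun x => ρ (ξ x))
    | .empty, ξ, ρ => by
      simp only [Ectx.rename, Ectx.den]
      rfl
    | .ite K e₁ e₂, ξ, ρ => by
      simp only [Ectx.rename, Ectx.den, Hom.mk₂, K.den_rename ξ ρ, e₁.den_rename ξ ρ,
        e₂.den_rename ξ ρ]
    | .appL K v, ξ, ρ => by
      simp only [Ectx.rename, Ectx.den, Hom.mk₂, K.den_rename ξ ρ, v.den_rename ξ ρ]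
    | .appR e K, ξ, ρ => by
      simp only [Ectx.rename, Ectx.den, Hom.mk₂, K.den_rename ξ ρ, e.den_rename ξ ρ]
    | .natopR op e K, ξ, ρ => by
      simp only [Ectx.rename, Ectx.den, Hom.mk₂, K.den_rename ξ ρ, e.den_rename ξ ρ]
    | .natopL op K v, ξ, ρ => by
      simp only [Ectx.rename, Ectx.den, Hom.mk₂, K.den_rename ξ ρ, v.den_rename ξ ρ]
    | .throwL K e, ξ, ρ => by
      simp only [Ectx.rename, Ectx.den, Hom.mk₂, K.den_rename ξ ρ, e.den_rename ξ ρ]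
    | .throwR v K, ξ, ρ => by
      simp only [Ectx.rename, Ectx.den, Hom.mk₂, K.den_rename ξ ρ, v.den_rename ξ ρ]
end

theorem extend_ups (s : ℕ → Expr) (ρ : Env B) (α : Tree B) :
    (fun x => (ups s x).den (extend ρ α)) = extend (fun x => (s x).den ρ) α := by
  funext x
  cases x with
  | zero => simp only [ups, Expr.den, extend]
  -- Reading `extend ρ α` at successors gives back `ρ` definitionally.
  | succ x => exact (s x).den_rename Nat.succ (extend ρ α)

-- Substitution corresponds to changing the environment. Contexts bind nothing, so `s` and `ρ` pass
-- through them unchanged; only `rec` and `callcc` need the lifting lemma, twice and once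
-- respectively.
mutual
  theorem Expr.den_subst : ∀ (e : Expr) (s : ℕ → Expr) (ρ : Env B),
      (e.subst s).den ρ = e.den (fun x => (s x).den ρ)
    | .val v, s, ρ => by
      simp only [Expr.subst, Expr.den]
      exact v.den_subst s ρ
    | .var x, s, ρ => by simp only [Expr.subst, Expr.den]
    | .app e₁ e₂, s, ρ => by
      simp only [Expr.subst, Expr.den, e₁.den_subst s ρ, e₂.den_subst s ρ]
    | .natop op e₁ e₂, s, ρ => by
      simp only [Expr.subst, Expr.den, e₁.den_subst s ρ, e₂.den_subst s ρ]
    | .ite e₁ e₂ e₃, s, ρ => by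
      simp only [Expr.subst, Expr.den, e₁.den_subst s ρ, e₂.den_subst s ρ, e₃.den_subst s ρ]
    | .callcc e, s, ρ => by
      simp only [Expr.subst, Expr.den]
      exact callccDen_congr fun α => by rw [e.den_subst, extend_ups]
    | .throw e₁ e₂, s, ρ => by
      simp only [Expr.subst, Expr.den, e₁.den_subst s ρ, e₂.den_subst s ρ]
  theorem Val.den_subst : ∀ (v : Val) (s : ℕ → Expr) (ρ : Env B),
      (v.subst s).den ρ = v.den (fun x => (s x).den ρ)
    | .nat n, s, ρ => by
      simp only [Val.subst, Val.den]
      rfl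
    | .recv e, s, ρ => by
      simp only [Val.subst, Val.den]
      exact recDen_congr fun α β => by rw [e.den_subst, extend_ups, extend_ups]
    | .cont K, s, ρ => by
      simp only [Val.subst, Val.den, contDen, K.den_subst s ρ]
  theorem Ectx.den_subst : ∀ (K : Ectx) (s : ℕ → Expr) (ρ : Env B),
      (K.subst s).den ρ = K.den (fun x => (s x).den ρ)
    | .empty, s, ρ => by
      simp only [Ectx.subst, Ectx.den]
      rfl
    | .ite K e₁ e₂, s, ρ => by
      simp only [Ectx.subst, Ectx.den, Hom.mk₂, K.den_subst s ρ, e₁.den_subst s ρ,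
        e₂.den_subst s ρ]
    | .appL K v, s, ρ => by
      simp only [Ectx.subst, Ectx.den, Hom.mk₂, K.den_subst s ρ, v.den_subst s ρ]
    | .appR e K, s, ρ => by
      simp only [Ectx.subst, Ectx.den, Hom.mk₂, K.den_subst s ρ, e.den_subst s ρ]
    | .natopR op e K, s, ρ => by
      simp only [Ectx.subst, Ectx.den, Hom.mk₂, K.den_subst s ρ, e.den_subst s ρ]
    | .natopL op K v, s, ρ => by
      simp only [Ectx.subst, Ectx.den, Hom.mk₂, K.den_subst s ρ, v.den_subst s ρ]
    | .throwL K e, s, ρ => by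
      simp only [Ectx.subst, Ectx.den, Hom.mk₂, K.den_subst s ρ, e.den_subst s ρ]
    | .throwR v K, s, ρ => by
      simp only [Ectx.subst, Ectx.den, Hom.mk₂, K.den_subst s ρ, v.den_subst s ρ]
end

theorem Expr.den_subst_single (e : Expr) (v : Val) (ρ : Env B) :
    (e.subst (single v)).den ρ = e.den (extend ρ (v.den ρ)) := by
  rw [e.den_subst]
  congr 1
  funext x
  cases x <;> simp only [single, Expr.den, extend]

/-- The nesting matches the environment in the fixed-point equation `recDen_eq`: the recursive
function is added first and becomes index 1, the argument second and becomes index 0. -/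
theorem Expr.den_subst_double (e : Expr) (v₀ v₁ : Val) (ρ : Env B) :
    (e.subst (double v₀ v₁)).den ρ = e.den (extend (extend ρ (v₁.den ρ)) (v₀.den ρ)) := by
  rw [e.den_subst]
  congr 1
  funext x
  rcases x with _ | _ | x <;> simp only [double, Expr.den, extend]

-- Syntactic values and evaluation contexts.

theorem Val.isValue_den (v : Val) (ρ : Env B) : IsValue (v.den ρ) := by
  cases v with
  | nat n =>
    rw [Val.den]
    exact .ret _
  | recv e =>
    -- One unfolding of the fixed point is needed to expose the constructor `Fun`.
    rw [Val.den, recDen_eq]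
    exact .fn _
  | cont K =>
    rw [Val.den]
    exact .fn _

theorem Ectx.den_plug : ∀ (K : Ectx) (e : Expr) (ρ : Env B),
    (K.plug e).den ρ = K.den ρ (e.den ρ)
  | .empty, e, ρ => by
    simp only [Ectx.plug, Ectx.den]
    rfl
  | .ite K _ _, e, ρ => by simp only [Ectx.plug, Ectx.den, Expr.den, Hom.mk₂, K.den_plug e ρ]
  | .appL K _, e, ρ => by simp only [Ectx.plug, Ectx.den, Expr.den, Hom.mk₂, K.den_plug e ρ]
  | .appR _ K, e, ρ => by simp only [Ectx.plug, Ectx.den, Expr.den, Hom.mk₂, K.den_plug e ρ]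
  | .natopR _ _ K, e, ρ => by simp only [Ectx.plug, Ectx.den, Expr.den, Hom.mk₂, K.den_plug e ρ]
  | .natopL _ K _, e, ρ => by simp only [Ectx.plug, Ectx.den, Expr.den, Hom.mk₂, K.den_plug e ρ]
  | .throwL K _, e, ρ => by simp only [Ectx.plug, Ectx.den, Expr.den, Hom.mk₂, K.den_plug e ρ]
  | .throwR _ K, e, ρ => by simp only [Ectx.plug, Ectx.den, Expr.den, Hom.mk₂, K.den_plug e ρ]

/-- Once the operand that is evaluated first is a value, the operation becomes a single `getval` in
its other operand; this and the next two lemmas serve the frames `throw v K`, `K ⊕ v` and `K v`. The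
fixed operand there is a syntactic value, never a variable, so nothing has to be assumed about the
trees in the environment. -/
theorem throwTree_of_isValue {α : Tree B} (h : IsValue α) (β : Tree B) :
    throwTree α β = getfun ⟨fun f => THROW (.next α) f,
      fun h => THROW_ne (dist_refl _ _) h⟩ β := h.getval _

theorem NATOP_of_isValue (op : ℕ → ℕ → ℕ) (α : Tree B) {β : Tree B} (h : IsValue β) :
    NATOP op α β = getval ⟨fun αv => onNat (fun m => onNat (fun n => Ret (.inl (op n m))) αv) β,
      fun h => Hom.dist_app (onNat.ne fun _ => Hom.ne _ h) (dist_refl _ _)⟩ α := h.getval _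

theorem APP_of_isValue (α : Tree B) {β : Tree B} (h : IsValue β) :
    APP α β = getfun ⟨fun g => Tau (Later.ap g (.next β)),
      fun h => IT.fold.ne (.tau (Later.dist_ap h (dist_refl _ _)))⟩ α := h.getval _

/-- In the frames proved by `rfl` the hole is the operand evaluated first, so the outermost `getval`
already acts on it. In the other three, the operand evaluated first is a value and its evaluation
has to be discharged beforehand. -/
theorem Ectx.isHomomorphism_den : ∀ (K : Ectx) (ρ : Env B), IsHomomorphism (K.den ρ)
  | .empty, ρ => by
    rw [Ectx.den]
    exact .id
  | .ite K e₁ e₂, ρ => by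
    rw [Ectx.den]
    exact (K.isHomomorphism_den ρ).of_getval fun _ => rfl
  | .appL K v, ρ => by
    rw [Ectx.den]
    exact (K.isHomomorphism_den ρ).of_getval fun _ => APP_of_isValue _ (v.isValue_den ρ)
  | .appR e K, ρ => by
    rw [Ectx.den]
    exact (K.isHomomorphism_den ρ).of_getval fun _ => rfl
  | .natopR op e K, ρ => by
    rw [Ectx.den]
    exact (K.isHomomorphism_den ρ).of_getval fun _ => rfl
  | .natopL op K v, ρ => by
    rw [Ectx.den]
    exact (K.isHomomorphism_den ρ).of_getval fun _ => NATOP_of_isValue op _ (v.isValue_den ρ)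
  | .throwL K e, ρ => by
    rw [Ectx.den]
    exact (K.isHomomorphism_den ρ).of_getval fun _ => rfl
  | .throwR v K, ρ => by
    rw [Ectx.den]
    exact (K.isHomomorphism_den ρ).of_getval fun _ => throwTree_of_isValue (v.isValue_den ρ) _

-- Reductions inside a context.

theorem den_beta (e : Expr) (v : Val) (ρ : Env B) :
    (Expr.app (.val (.recv e)) (.val v)).den ρ = Tick ((e.subst (double v (.recv e))).den ρ) := by
  rw [e.den_subst_double]
  simp only [Expr.den, Val.den]
  -- The first rewrite also unfolds the copy of the fixed point in the environment on the right; the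
  -- last one folds that copy back.
  rw [recDen_eq, APP_Fun _ (v.isValue_den ρ), ← recDen_eq]
  rfl

/-- Commuting with `Vis` composes the identity continuation with `▶h`, so the reifier's `κ` is `▶h`
itself: it is both handed to `f` and applied to the result. -/
theorem isteps_CALLCC {h : Tree B →ₙₑ Tree B} (hh : IsHomomorphism h)
    (f : (▶(Tree B) →ₙₑ ▶(Tree B)) →ₙₑ ▶(Tree B)) :
    ISteps (reifier B) (h (CALLCC f), ()) (h (f (Later.map h)).val, ()) := by
  rw [show h (CALLCC f) = _ from hh.map_Vis _ _ _]
  exact .vis (reifier B) rfl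

/-- The map `h` disappears from the result because it only alters a continuation out of the empty
type, which the reifier for `throw` discards. -/
theorem isteps_THROW {h : Tree B →ₙₑ Tree B} (hh : IsHomomorphism h) (α : ▶(Tree B))
    (f : ▶(Tree B →ₙₑ Tree B)) :
    ISteps (reifier B) (h (THROW α f), ()) (f.val α.val, ()) := by
  rw [show h (THROW α f) = _ from hh.map_Vis _ _ _]
  exact .vis (reifier B) rfl

theorem LocalStep.sound {K : Ectx} {e₁ e₂ : Expr} (h : LocalStep K e₁ e₂) (ρ : Env B) :
    ISteps (reifier B) (K.den ρ (e₁.den ρ), ()) (K.den ρ (e₂.den ρ), ()) := by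
  cases h with
  | beta e v =>
    rw [den_beta, Tick, (K.isHomomorphism_den ρ).map_Tau]
    exact .tick (reifier B) _ _
  | natop op n m =>
    have h : (Expr.natop op (.val (.nat n)) (.val (.nat m))).den ρ
        = (Expr.val (.nat (op n m))).den ρ := by
      simp only [Expr.den, Val.den]
      exact NATOP_Ret op n m
    rw [h]
    exact .refl
  | iteTrue n _ e₃ hn =>
    have h : (Expr.ite (.val (.nat n)) e₂ e₃).den ρ = e₂.den ρ := by
      simp only [Expr.den, Val.den]
      exact (IF_Ret n _ _).trans (if_neg hn)
    rw [h]
    exact .refl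
  | iteFalse e₃ _ =>
    have h : (Expr.ite (.val (.nat 0)) e₃ e₂).den ρ = e₂.den ρ := by
      simp only [Expr.den, Val.den]
      exact (IF_Ret 0 _ _).trans (if_pos rfl)
    rw [h]
    exact .refl
  | callcc e =>
    rw [e.den_subst_single, Expr.den, Val.den]
    -- The value that the body receives, `reflectFun` of `▶K`, is by definition the denotation of
    -- `cont K` in the same environment.
    exact isteps_CALLCC (K.isHomomorphism_den ρ) _

/-- Two reductions occur: reifying `throw` drops `K` and applies the function denoted by `cont K'`,
and that function delays its call to `K'` by one tick. -/
theorem throw_sound (K K' : Ectx) (v : Val) (ρ : Env B) :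
    ISteps (reifier B) (K.den ρ ((Expr.throw (.val v) (.val (.cont K'))).den ρ), ())
      (K'.den ρ (v.den ρ), ()) := by
  simp only [Expr.den, Val.den]
  rw [throwTree_of_isValue (v.isValue_den ρ)]
  -- The denotation of a continuation is a `Fun` by definition, so `getfun` fires immediately.
  change ISteps (reifier B) (K.den ρ (getfun _ (Fun _)), ()) _
  rw [getfun_Fun]
  exact (isteps_THROW (K.isHomomorphism_den ρ) _ _).trans (ISteps.tick (reifier B) _ _)

end CallCC

theorem mainTheorem1 (B : Type) [GITree.COFE B] (e₁ e₂ : CallCC.Expr)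
    (h : CallCC.Step e₁ e₂) (ρ : CallCC.Env B) :
    GITree.ISteps (CallCC.reifier B) (e₁.den ρ, ()) (e₂.den ρ, ()) := by
  cases h with
  | plug K h =>
    rw [K.den_plug, K.den_plug]
    exact h.sound ρ
  | throw K K' v =>
    rw [K.den_plug, K'.den_plug, show (CallCC.Expr.val v).den ρ = v.den ρ by rw [CallCC.Expr.den]]
    exact CallCC.throw_sound K K' v ρ
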